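/- For every $N\ge 1$ let $G_1,G_2,\dots$ be i.i.d. complex Ginibre matrices of size $N\times N$, scaled so that all entries are independent with law $\mathscr N_{\mathbb C}(0,1/N)$; here $\mathscr N_{\mathbb C}(0,\sigma^2)$ denotes the law of $X+iY$ with $X,Y$ independent real centered Gaussian variables of variance $\sigma^2/2$ (the Dirac mass at $0$ if $\sigma^2=0$). Let $w=G_{i_1}G_{i_2}\cdots G_{i_m}$, $m\ge 1$, be a fixed non-empty $*$-free word, that is, a word in the letters $G_1,G_2,\dots$ only and not their conjugate transposes; let $G_w$ be the corresponding product of matrices, and let $\mathrm{cop}(w)=\max\{k : w=u^k \text{ for some word } u\}$ be the coperiod of $w$. Let $f$ be a polynomial with complex coefficients, and let $S_N(f)=\sum_{i=1}^N f(\lambda_i)$, where $\lambda_1,\dots,\lambda_N$ are the eigenvalues of $G_w$ counted with algebraic multiplicity. Then $$S_N(f)-Nf(0)\ \xrightarrow[N\to\infty]{d}\ \mathscr N_{\mathbb C}(0,\sigma_f^2),\qquad \sigma_f^2=\mathrm{cop}(w)\int_{\mathbb D}|\nabla f(z)|^2\,dm(z),$$ where $\mathbb D=\{z\in\mathbb C:|z|<1\}$,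 $m$ is the normalized area measure on $\mathbb D$ ($dm=\frac1\pi\,dx\,dy$), and $|\nabla f(z)|=|f'(z)|$ is the modulus of the complex derivative. -/

import Mathlib

open MeasureTheory ProbabilityTheory Filter
open scoped NNReal Polynomial

noncomputable section

/-- The centered circular complex Gaussian law `𝒩_ℂ(0, v)` on `ℂ`: the law of `X + iY` with `X, Y`
independent real centered Gaussians of variance `v / 2`. For `v = 0` it is the Dirac mass at `0`. -/
def complexGaussian (v : ℝ≥0) : Measure ℂ :=
  ((gaussianReal 0 (v / 2)).prod (gaussianReal 0 (v / 2))).map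
    (fun p : ℝ × ℝ => (p.1 : ℂ) + (p.2 : ℂ) * Complex.I)

instance isProbabilityMeasure_complexGaussian (v : ℝ≥0) :
    IsProbabilityMeasure (complexGaussian v) :=
  Measure.isProbabilityMeasure_map (by fun_prop)

/-- `G 0, G 1, …` are i.i.d. complex Ginibre matrices of size `N × N`, scaled so that every entry
has variance `1 / N`: all entries of all matrices are jointly independent, with law
`𝒩_ℂ(0, 1 / N)`. -/
structure IsIIDGinibre {Ω : Type*} [MeasurableSpace Ω] (P : Measure Ω) (N : ℕ)
    (G : ℕ → Ω → Matrix (Fin N) (Fin N) ℂ) : Prop where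
  indep : iIndepFun (fun (p : ℕ × Fin N × Fin N) (ω : Ω) => G p.1 ω p.2.1 p.2.2) P
  law : ∀ r i j, HasLaw (fun ω => G r ω i j) (complexGaussian (N : ℝ≥0)⁻¹) P

/-- The matrix `G_w = G_{i_1} ⋯ G_{i_m}` of a `*`-free word `w = i_1 ⋯ i_m`; such words are the
elements of the free monoid on the set of indices of the matrices. -/
def wordMatrix {N : ℕ} (w : FreeMonoid ℕ) (G : ℕ → Matrix (Fin N) (Fin N) ℂ) :
    Matrix (Fin N) (Fin N) ℂ :=
  FreeMonoid.lift G w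

/-- The coperiod of a (nonempty) word: the largest `k` such that `w` is a `k`-th power. -/
def coperiod (w : FreeMonoid ℕ) : ℕ := sSup {k : ℕ | ∃ u : FreeMonoid ℕ, w = u ^ k}

/-- `∑ f(λ_i)`, over the eigenvalues of `M`, counted with algebraic multiplicity. -/
def linearStatistic {N : ℕ} (f : ℂ[X]) (M : Matrix (Fin N) (Fin N) ℂ) : ℂ :=
  (M.charpoly.roots.map (fun z => f.eval z)).sum

/-- `∫_𝔻 |∇f|² dm`, where `m` is the normalized area measure on the unit disk `𝔻` (total mass `1`)
and `|∇f| = |f'|` is the modulus of the complex derivative. -/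
def dirichletEnergy (f : ℂ[X]) : ℝ :=
  Real.pi⁻¹ * ∫ z in Metric.ball (0 : ℂ) 1, ‖deriv (fun x => f.eval x) z‖ ^ 2

lemma dirichletEnergy_nonneg (f : ℂ[X]) : 0 ≤ dirichletEnergy f :=
  mul_nonneg (inv_nonneg.2 Real.pi_pos.le) (integral_nonneg fun _ => by positivity)

/-- The limiting variance `cop(w) ∫_𝔻 |∇f|² dm`. -/
def limitVariance (w : FreeMonoid ℕ) (f : ℂ[X]) : ℝ≥0 :=
  ⟨(coperiod w : ℝ) * dirichletEnergy f,
    mul_nonneg (Nat.cast_nonneg _) (dirichletEnergy_nonneg f)⟩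

end

open scoped ComplexConjugate Topology

/-! ### Spectral mapping with multiplicities, and linear statistics as traces of powers -/

namespace Matrix

variable {n : Type*} [Fintype n] [DecidableEq n] {K : Type*} [Field K] [IsAlgClosed K]

/-! By spectral mapping, the centred statistic is a finite combination of the traces `Tr(G_w^k)`, `k
≥ 1`, with the coefficients of `f` (`linearStatistic_sub_eq`). It is a polynomial in independent
Gaussian entries, so the limit law can be found by moments.

Gaussian integration by parts yields a loop equation
(`IsGinibreFunctional.loop_equation_traceEval`). Removing the first letter `x` of a trace either
splits that trace in two at an occurrence of the adjoint of `x`, or, at relative cost `N⁻²`, glues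
it to another trace containing that adjoint. Induction on total length shows that expectations of
polynomials in normalized traces converge to a multiplicative limit (`tendsto_traceEval`).

For unnormalized traces of `*`-free words the splitting term is absent, and gluing pairs such a
trace only with a conjugated one; the factors of `N` then balance exactly. In the limit the mixed
moments of the statistic `ξ` and its conjugate satisfy `m(a+1,b) = s · b · m(a,b-1)`, the recursion
of the complex Gaussian moments (`tendsto_mixed_moment`, `gaussianMoment_succ_left`).

The covariance of `Tr(G_w^k)` and `Tr(G_w^l)` tends to the number of rotations carrying one word to
the other, since a `*`-free word followed by the adjoint of another has limiting trace one or zero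
according to whether they agree (`limitTrace_posWord_append_negWord`). That number is `k · cop(w)`
for `k = l` and zero otherwise (`card_rotate_pow_eq`). Thus `s = cop(w) ∑ k |f_k|²`, which is the
Dirichlet energy by orthogonality of monomials on the disk (`dirichletEnergy_eq_sum`). The moment
method for characteristic functions then gives convergence in law. -/

theorem charpoly_eq_prod_roots (A : Matrix n n K) :
    A.charpoly = (A.charpoly.roots.map fun r => Polynomial.X - Polynomial.C r).prod :=
  (IsAlgClosed.splits A.charpoly).eq_prod_roots_of_monic A.charpoly_monic

theorem card_roots_charpoly (A : Matrix n n K) :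
    A.charpoly.roots.card = Fintype.card n := by
  rw [← A.charpoly_natDegree_eq_dim]
  exact (IsAlgClosed.splits A.charpoly).natDegree_eq_card_roots.symm

theorem det_sub_scalar_eq_prod_roots (A : Matrix n n K) (a : K) :
    (A - scalar n a).det = (A.charpoly.roots.map fun r => r - a).prod := by
  have h : (scalar n a - A).det = (A.charpoly.roots.map fun r => a - r).prod := by
    rw [← Matrix.eval_charpoly]
    conv_lhs => rw [charpoly_eq_prod_roots]
    simp [Polynomial.eval_multiset_prod]
  rw [← neg_sub, Matrix.det_neg, h, ← card_roots_charpoly A]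
  rw [← Multiset.card_map (fun r => a - r) A.charpoly.roots, ← Multiset.prod_map_neg]
  simp

/-- Factor `q` into linear terms: the determinant is multiplicative, and each factor `A - a`
contributes the product of `r - a` over the eigenvalues. -/
theorem det_aeval_eq_prod_roots (A : Matrix n n K) (q : K[X]) :
    (Polynomial.aeval A q).det = (A.charpoly.roots.map fun r => q.eval r).prod := by
  have hq := (IsAlgClosed.splits q).eq_prod_roots
  generalize q.roots = s at hq
  rw [hq]
  have key : ∀ s : Multiset K,
      (Polynomial.aeval A (s.map fun a => Polynomial.X - Polynomial.C a).prod).det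
        = (A.charpoly.roots.map fun r =>
          (s.map fun a => Polynomial.X - Polynomial.C a).prod.eval r).prod := by
    intro s
    induction s using Multiset.induction with
    | empty => simp
    | cons a s ih =>
      simp only [Multiset.map_cons, Multiset.prod_cons, map_mul, det_mul, ih,
        Polynomial.eval_mul, Multiset.prod_map_mul]
      congr 1
      simpa [Matrix.algebraMap_eq_diagonal, Pi.algebraMap_def] using det_sub_scalar_eq_prod_roots A a
  simp only [map_mul, det_mul, key, Polynomial.eval_mul, Multiset.prod_map_mul]
  congr 1
  simp [card_roots_charpoly, Matrix.algebraMap_eq_diagonal, Pi.algebraMap_def]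

/-- The characteristic polynomial of `q(A)` at `t` is the determinant of the polynomial `t - q`
evaluated at `A`, so the preceding determinant formula factors it. -/
theorem roots_charpoly_aeval (A : Matrix n n K) (q : K[X]) :
    (Polynomial.aeval A q).charpoly.roots = A.charpoly.roots.map fun r => q.eval r := by
  have h : (Polynomial.aeval A q).charpoly
      = ((A.charpoly.roots.map fun r => q.eval r).map
        fun a => Polynomial.X - Polynomial.C a).prod := by
    refine Polynomial.funext fun t => ?_
    have h1 := det_aeval_eq_prod_roots A (Polynomial.C t - q)
    rw [Matrix.eval_charpoly]
    simp only [map_sub, Polynomial.aeval_C] at h1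
    simp only [Multiset.map_map, Polynomial.eval_multiset_prod, Function.comp_def]
    simpa [Matrix.algebraMap_eq_diagonal, Pi.algebraMap_def] using h1
  rw [h, Polynomial.roots_multiset_prod_X_sub_C]

theorem sum_eval_roots_charpoly (A : Matrix n n K) (q : K[X]) :
    (A.charpoly.roots.map fun r => q.eval r).sum = (Polynomial.aeval A q).trace := by
  rw [Matrix.trace_eq_sum_roots_charpoly, roots_charpoly_aeval]

end Matrix

theorem linearStatistic_sub_eq {N : ℕ} (f : ℂ[X]) (M : Matrix (Fin N) (Fin N) ℂ) :
    linearStatistic f M - (N : ℂ) * f.eval 0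
      = ∑ k ∈ Finset.range f.natDegree, f.coeff (k + 1) * (M ^ (k + 1)).trace := by
  rw [linearStatistic, Matrix.sum_eval_roots_charpoly, Polynomial.aeval_eq_sum_range,
    Finset.sum_range_succ', Matrix.trace_add, Matrix.trace_sum]
  simp [Matrix.trace_smul, Polynomial.coeff_zero_eq_eval_zero, mul_comm]

/-! ### Rotations, powers and coperiod of words -/

namespace FreeMonoid

variable {α : Type*}

theorem toList_ne_nil {w : FreeMonoid α} (hw : w ≠ 1) : toList w ≠ [] := fun h => hw h

theorem length_toList_pow (u : FreeMonoid α) (k : ℕ) :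
    (toList (u ^ k)).length = k * (toList u).length := by
  induction k with
  | zero => simp
  | succ k ih => rw [pow_succ, toList_mul, List.length_append, ih]; ring

theorem rotate_toList_pow (w : FreeMonoid α) (k q : ℕ) :
    (toList (w ^ k)).rotate q = toList ((ofList ((toList w).rotate q)) ^ k) := by
  induction q generalizing w with
  | zero => simp
  | succ q ih =>
    have h1 : (toList (w ^ k)).rotate 1 = toList ((ofList ((toList w).rotate 1)) ^ k) := by
      induction w using FreeMonoid.casesOn with
      | one => simp
      | of_mul a t =>
        have hr : ofList ((toList (of a * t)).rotate 1) = t * of a := by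
          rw [toList_of_mul, List.rotate_cons_succ, List.rotate_zero]
          rfl
        rw [hr]
        cases k with
        | zero => simp
        | succ k =>
          -- Moving the first letter to the end: `t` slides through `(a t)^k`, turning it into `(t
          -- a)^k`.
          have h2 : (t * of a) ^ (k + 1) = t * (of a * t) ^ k * of a := by
            rw [pow_succ, ← mul_assoc]
            congr 1
            have : SemiconjBy t (of a * t) (t * of a) := by
              simp [SemiconjBy, mul_assoc]
            exact (this.pow_right k).eq.symm
          rw [h2, pow_succ', mul_assoc (of a), toList_of_mul, List.rotate_cons_succ, List.rotate_zero]
          rfl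
    rw [add_comm, ← List.rotate_rotate, h1, ih, ← List.rotate_rotate]
    rfl

theorem eq_of_pow_eq_pow {u v : FreeMonoid α} {k l : ℕ} (h : u ^ k = v ^ l)
    (hlen : (toList u).length = (toList v).length) (hv : v ≠ 1) (hl : l ≠ 0) :
    k = l ∧ u = v := by
  have hpos : 0 < (toList v).length := List.length_pos_iff.2 (toList_ne_nil hv)
  have hkl : k = l := by
    have := congrArg (fun x => (toList x).length) h
    simp only [length_toList_pow, hlen] at this
    exact Nat.eq_of_mul_eq_mul_right hpos this
  refine ⟨hkl, ?_⟩
  obtain ⟨l, rfl⟩ := Nat.exists_eq_succ_of_ne_zero hl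
  subst hkl
  rw [Nat.succ_eq_add_one, pow_succ', pow_succ'] at h
  have h' := congrArg toList h
  rw [toList_mul, toList_mul] at h'
  exact (List.append_inj h' hlen).1

/-- A rotation of `w ^ k` is the `k`-th power of a rotation of `w`, and words of equal length with
equal powers coincide. -/
theorem pow_rotate_eq_pow_iff {w : FreeMonoid α} (hw : w ≠ 1) {k l : ℕ} (hl : l ≠ 0) (q : ℕ) :
    (toList (w ^ k)).rotate q = toList (w ^ l) ↔
      k = l ∧ (toList w).rotate q = toList w := by
  rw [rotate_toList_pow]
  constructor
  · intro h
    have h' : (ofList ((toList w).rotate q)) ^ k = w ^ l := toList.injective h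
    have := eq_of_pow_eq_pow h' (by simp) hw hl
    exact ⟨this.1, congrArg toList this.2⟩
  · rintro ⟨rfl, h⟩
    rw [h]
    rfl

/-- A word commuting with its prefix `u`, of length a multiple of `|u|`, is a power of `u`. -/
theorem eq_pow_of_commute {u : FreeMonoid α} (k : ℕ) (s : FreeMonoid α)
    (hs : (toList s).length = k * (toList u).length) (h : u * s = s * u) : s = u ^ k := by
  induction k generalizing s with
  | zero => exact toList.injective (List.length_eq_zero_iff.1 (by simpa using hs))
  | succ k ih =>
    have h' := congrArg toList h
    rw [toList_mul, toList_mul] at h'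
    have hle : (toList u).length ≤ (toList s).length := by rw [hs]; nlinarith
    have hp : toList u <+: toList s :=
      List.prefix_of_prefix_length_le (List.prefix_append _ _)
        (h'.symm ▸ List.prefix_append _ _) hle
    obtain ⟨s', hs'⟩ := hp
    obtain rfl : s = u * ofList s' := toList.injective (by rw [toList_mul]; exact hs'.symm)
    rw [pow_succ', ← ih (ofList s')]
    · rw [toList_mul, List.length_append] at hs
      have : (k + 1) * (toList u).length = k * (toList u).length + (toList u).length := by ring
      omega
    · rw [mul_assoc] at h
      exact mul_left_cancel h

theorem iterate_rotate_one (l : List α) (q : ℕ) : (fun l : List α => l.rotate 1)^[q] l = l.rotate q := by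
  induction q with
  | zero => simp
  | succ q ih => rw [Function.iterate_succ_apply', ih, List.rotate_rotate]

/-- The least positive rotation fixing a list. -/
noncomputable def _root_.List.rotatePeriod (l : List α) : ℕ := Function.minimalPeriod (fun l : List α => l.rotate 1) l

theorem rotate_eq_self_iff (l : List α) (q : ℕ) : l.rotate q = l ↔ l.rotatePeriod ∣ q := by
  rw [List.rotatePeriod, ← Function.isPeriodicPt_iff_minimalPeriod_dvd, Function.IsPeriodicPt,
    Function.IsFixedPt, iterate_rotate_one]

theorem rotatePeriod_dvd_length (l : List α) : l.rotatePeriod ∣ l.length :=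
  (rotate_eq_self_iff l _).1 (List.rotate_length l)

theorem rotatePeriod_pos {l : List α} (hl : l ≠ []) : 0 < l.rotatePeriod :=
  Nat.pos_of_dvd_of_pos (rotatePeriod_dvd_length l) (List.length_pos_iff.2 hl)

/-- Cut `w = u s` with `|u|` the rotation period. Invariance under that rotation says `s u = u s`,
and the period divides the length, so `s` is a power of `u`. -/
theorem exists_eq_pow_div_rotatePeriod {w : FreeMonoid α} (hw : w ≠ 1) :
    ∃ u : FreeMonoid α, w = u ^ ((toList w).length / (toList w).rotatePeriod) := by
  set d := (toList w).rotatePeriod with hd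
  have hd0 : 0 < d := rotatePeriod_pos (toList_ne_nil hw)
  obtain ⟨e, he⟩ := rotatePeriod_dvd_length (toList w)
  rw [← hd] at he
  have hpos : 0 < (toList w).length := List.length_pos_iff.2 (toList_ne_nil hw)
  have hdl : d ≤ (toList w).length := Nat.le_of_dvd hpos ⟨e, he⟩
  have hrot : (toList w).rotate d = toList w := (rotate_eq_self_iff _ _).2 dvd_rfl
  rw [List.rotate_eq_drop_append_take hdl] at hrot
  let u : FreeMonoid α := ofList ((toList w).take d)
  let s : FreeMonoid α := ofList ((toList w).drop d)
  have hus : u * s = w := toList.injective (List.take_append_drop d _)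
  have hsu : s * u = w := toList.injective hrot
  have hul : (toList u).length = d := by simp [u, hdl]
  have he0 : e ≠ 0 := by rintro rfl; omega
  have hs : s = u ^ (e - 1) := by
    refine eq_pow_of_commute _ _ ?_ (hus.trans hsu.symm)
    rw [hul]
    simp only [s, toList_ofList, List.length_drop, he]
    rw [Nat.sub_mul, one_mul, mul_comm]
  refine ⟨u, ?_⟩
  rw [he, Nat.mul_div_cancel_left _ hd0]
  conv_lhs => rw [← hus, hs, ← pow_succ', Nat.sub_add_cancel (Nat.one_le_iff_ne_zero.2 he0)]

end FreeMonoid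

open FreeMonoid in
-- For maximality: if `w = u ^ k`, rotation by `|u|` fixes `w`, so the period is at most `|u|`.
theorem coperiod_eq_div_rotatePeriod {w : FreeMonoid ℕ} (hw : w ≠ 1) :
    coperiod w = (toList w).length / (toList w).rotatePeriod := by
  refine IsGreatest.csSup_eq ⟨exists_eq_pow_div_rotatePeriod hw, ?_⟩
  rintro k ⟨u, hu⟩
  have hpos : 0 < (toList w).length := List.length_pos_iff.2 (toList_ne_nil hw)
  have hd0 := rotatePeriod_pos (toList_ne_nil hw)
  have hlen : (toList w).length = k * (toList u).length := by rw [hu, length_toList_pow]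
  have hu0 : 0 < (toList u).length := Nat.pos_of_mul_pos_left (hlen ▸ hpos)
  have hrot : (toList w).rotate (toList u).length = toList w := by
    rw [hu, rotate_toList_pow, List.rotate_length]
    rfl
  have hle := Nat.le_of_dvd hu0 ((rotate_eq_self_iff _ _).1 hrot)
  rw [Nat.le_div_iff_mul_le hd0, hlen]
  exact Nat.mul_le_mul_left k hle

open FreeMonoid in
-- This is where the coperiod enters the variance. When `k = l`, the admissible rotations are the
-- multiples of the period of `w` below `k |w|`.
theorem card_rotate_pow_eq {w : FreeMonoid ℕ} (hw : w ≠ 1) (k : ℕ) {l : ℕ} (hl : l ≠ 0) :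
    ((Finset.range (k * (toList w).length)).filter
      fun q => (toList (w ^ k)).rotate q = toList (w ^ l)).card
      = if k = l then k * coperiod w else 0 := by
  simp only [pow_rotate_eq_pow_iff hw hl]
  split_ifs with hkl
  · simp only [hkl, true_and, rotate_eq_self_iff]
    rw [coperiod_eq_div_rotatePeriod hw]
    have hd0 := rotatePeriod_pos (toList_ne_nil hw)
    obtain ⟨e, he⟩ := rotatePeriod_dvd_length (toList w)
    rw [he, Nat.mul_div_cancel_left _ hd0]
    set d := (toList w).rotatePeriod
    have : (Finset.range (l * (d * e))).filter (fun q => d ∣ q)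
        = (Finset.range (l * e)).image (fun j => d * j) := by
      ext q
      simp only [Finset.mem_filter, Finset.mem_range, Finset.mem_image]
      constructor
      · rintro ⟨h1, j, rfl⟩
        exact ⟨j, by nlinarith [Nat.lt_of_mul_lt_mul_left (a := d) (by nlinarith : d * j < d * (l * e))], rfl⟩
      · rintro ⟨j, h1, rfl⟩
        exact ⟨by nlinarith, dvd_mul_right _ _⟩
    rw [this, Finset.card_image_of_injective _ (fun a b h => Nat.eq_of_mul_eq_mul_left hd0 h),
      Finset.card_range]
  · simp [hkl]

/-! ### Integration by parts for the real Gaussian -/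

section RealGaussian

theorem integrable_pow_gaussianReal (v : ℝ≥0) (n : ℕ) :
    Integrable (fun x : ℝ => x ^ n) (gaussianReal 0 v) := by
  have h := (memLp_id_gaussianReal (μ := 0) (v := v) (n : ℝ≥0)).integrable_norm_pow'
  simp only [id] at h
  exact h.mono (by fun_prop) (by simp)

theorem hasDerivAt_gaussianPDFReal {v : ℝ≥0} (hv : v ≠ 0) (x : ℝ) :
    HasDerivAt (gaussianPDFReal 0 v) (-(x / v) * gaussianPDFReal 0 v x) x := by
  have hv' : (v : ℝ) ≠ 0 := by exact_mod_cast hv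
  rw [gaussianPDFReal_def]
  have h1 : HasDerivAt (fun x : ℝ => -(x - 0) ^ 2 / (2 * (v : ℝ))) (-(x / v)) x := by
    have := ((((hasDerivAt_id x).sub_const 0).pow 2).neg).div_const (2 * (v : ℝ))
    refine this.congr_deriv ?_
    simp
    field_simp
  refine ((h1.exp).const_mul (√(2 * Real.pi * v))⁻¹).congr_deriv ?_
  ring

theorem integrable_pow_mul_gaussianPDFReal {v : ℝ≥0} (hv : v ≠ 0) (n : ℕ) :
    Integrable (fun x : ℝ => x ^ n * gaussianPDFReal 0 v x) := by
  have h := integrable_pow_gaussianReal v n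
  rw [gaussianReal_of_var_ne_zero 0 hv, integrable_withDensity_iff (by fun_prop)
    (ae_of_all _ fun x => gaussianPDF_lt_top)] at h
  simpa [toReal_gaussianPDF] using h

theorem integral_pow_succ_gaussianReal (v : ℝ≥0) (n : ℕ) :
    ∫ x, x ^ (n + 1) ∂gaussianReal 0 v = v * (n * ∫ x, x ^ (n - 1) ∂gaussianReal 0 v) := by
  rcases eq_or_ne v 0 with rfl | hv
  · simp
  have hv' : (v : ℝ) ≠ 0 := by exact_mod_cast hv
  have h := integral_mul_deriv_eq_deriv_mul_of_integrable (A := ℝ)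
    (u := fun x : ℝ => x ^ n) (u' := fun x => n * x ^ (n - 1)) (v := gaussianPDFReal 0 v)
    (v' := fun x => -(x / v) * gaussianPDFReal 0 v x)
    (fun x _ => hasDerivAt_pow n x) (fun x _ => hasDerivAt_gaussianPDFReal hv x) ?_ ?_ ?_
  · simp only [integral_gaussianReal_eq_integral_smul hv, smul_eq_mul]
    have e1 : ∫ x : ℝ, x ^ n * (-(x / v) * gaussianPDFReal 0 v x)
        = -((v : ℝ)⁻¹ * ∫ x : ℝ, gaussianPDFReal 0 v x * x ^ (n + 1)) := by
      rw [← integral_const_mul, ← integral_neg]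
      congr 1; ext x; ring
    have e2 : ∫ x : ℝ, (n * x ^ (n - 1)) * gaussianPDFReal 0 v x
        = n * ∫ x : ℝ, gaussianPDFReal 0 v x * x ^ (n - 1) := by
      rw [← integral_const_mul]
      congr 1; ext x; ring
    rw [e1, e2, neg_inj] at h
    rw [← h, mul_inv_cancel_left₀ hv']
  · convert (integrable_pow_mul_gaussianPDFReal hv (n + 1)).const_mul (-(v : ℝ)⁻¹) using 1
    ext x; simp; ring
  · convert (integrable_pow_mul_gaussianPDFReal hv (n - 1)).const_mul (n : ℝ) using 1
    ext x; simp; ring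
  · exact integrable_pow_mul_gaussianPDFReal hv n

theorem integrable_eval_gaussianReal (v : ℝ≥0) (p : ℂ[X]) :
    Integrable (fun x : ℝ => p.eval (x : ℂ)) (gaussianReal 0 v) := by
  simp only [Polynomial.eval_eq_sum_range]
  refine integrable_finsetSum _ fun k _ => Integrable.const_mul ?_ _
  exact_mod_cast (integrable_pow_gaussianReal v k).ofReal (𝕜 := ℂ)

/-- Stein's identity for polynomials. -/
theorem integral_mul_eval_gaussianReal (v : ℝ≥0) (p : ℂ[X]) :
    ∫ x : ℝ, (x : ℂ) * p.eval (x : ℂ) ∂gaussianReal 0 v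
      = v * ∫ x : ℝ, p.derivative.eval (x : ℂ) ∂gaussianReal 0 v := by
  have hX : ∀ q : ℂ[X], Integrable (fun x : ℝ => (x : ℂ) * q.eval (x : ℂ)) (gaussianReal 0 v) :=
    fun q =>
      (integrable_eval_gaussianReal v (Polynomial.X * q)).congr (ae_of_all _ fun x => by simp)
  induction p using Polynomial.induction_on' with
  | add p q hp hq =>
    simp only [Polynomial.eval_add, mul_add, Polynomial.derivative_add]
    rw [integral_add (hX p) (hX q), hp, hq, integral_add (integrable_eval_gaussianReal v _)
      (integrable_eval_gaussianReal v _), mul_add]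
  | monomial n a =>
    have h := congrArg (fun r : ℝ => a * (r : ℂ)) (integral_pow_succ_gaussianReal v n)
    simp only [Complex.ofReal_mul, ← integral_complex_ofReal, Complex.ofReal_natCast] at h
    simp only [Polynomial.eval_monomial, Polynomial.derivative_monomial]
    rw [integral_const_mul]
    calc _ = a * ∫ x : ℝ, ((x ^ (n + 1) : ℝ) : ℂ) ∂gaussianReal 0 v := by
          rw [← integral_const_mul]; congr 1; ext x; push_cast; ring
      _ = _ := by rw [h]; push_cast; ring

end RealGaussian

/-! ### Random variables with finite moments of all orders -/

section AllMoments

variable {Ω : Type*} [MeasurableSpace Ω] {μ : Measure Ω}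

/-- All absolute moments of `f` are finite. -/
def HasAllMoments (f : Ω → ℂ) (μ : Measure Ω) : Prop := ∀ p : ℝ≥0, MemLp f p μ

/-- Hölder with `1/p = 1/(2p) + 1/(2p)`. -/
theorem HasAllMoments.mul {f g : Ω → ℂ} (hf : HasAllMoments f μ) (hg : HasAllMoments g μ) :
    HasAllMoments (fun ω => f ω * g ω) μ := fun p => by
  have : ENNReal.HolderTriple ((2 * p : ℝ≥0) : ENNReal) ((2 * p : ℝ≥0) : ENNReal) p := ⟨by
    rw [ENNReal.coe_mul, ENNReal.mul_inv (by simp) (by simp), ← add_mul]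
    simp [ENNReal.inv_two_add_inv_two]⟩
  exact (hg (2 * p)).mul (hf (2 * p))

theorem HasAllMoments.add {f g : Ω → ℂ} (hf : HasAllMoments f μ) (hg : HasAllMoments g μ) :
    HasAllMoments (fun ω => f ω + g ω) μ := fun p => (hf p).add (hg p)

theorem hasAllMoments_const [IsFiniteMeasure μ] (c : ℂ) : HasAllMoments (fun _ : Ω => c) μ :=
  fun _ => memLp_const c

theorem HasAllMoments.star {f : Ω → ℂ} (hf : HasAllMoments f μ) :
    HasAllMoments (fun ω => (starRingEnd ℂ) (f ω)) μ := fun p => (hf p).star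

theorem HasAllMoments.pow [IsFiniteMeasure μ] {f : Ω → ℂ} (hf : HasAllMoments f μ) (n : ℕ) :
    HasAllMoments (fun ω => f ω ^ n) μ := by
  induction n with
  | zero => simpa using hasAllMoments_const 1
  | succ n ih => simpa only [pow_succ] using ih.mul hf

theorem HasAllMoments.integrable {f : Ω → ℂ} (hf : HasAllMoments f μ) : Integrable f μ :=
  memLp_one_iff_integrable.1 (by simpa using hf 1)

end AllMoments

/-! ### Mixed moments of the complex Gaussian -/

section ComplexGaussian

theorem hasAllMoments_complexGaussian (v : ℝ≥0) :
    HasAllMoments (fun z : ℂ => z) (complexGaussian v) := fun p => by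
  rw [complexGaussian, memLp_map_measure_iff (by fun_prop) (by fun_prop)]
  have h1 : MemLp (fun x : ℝ => (x : ℂ)) p (gaussianReal 0 (v / 2)) :=
    (memLp_id_gaussianReal p).ofReal
  have h2 := h1.comp_fst (gaussianReal 0 (v / 2))
  have h3 := (h1.comp_snd (gaussianReal 0 (v / 2))).mul_const Complex.I
  exact h2.add h3

/-- The mixed moments of the complex Gaussian law. -/
noncomputable def gaussianMoment (v : ℝ≥0) (a b : ℕ) : ℂ :=
  ∫ z, z ^ a * conj z ^ b ∂complexGaussian v

theorem hasAllMoments_pow_mul_complexGaussian (v : ℝ≥0) (a b : ℕ) :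
    HasAllMoments (fun z : ℂ => z ^ a * conj z ^ b) (complexGaussian v) :=
  ((hasAllMoments_complexGaussian v).pow a).mul ((hasAllMoments_complexGaussian v).star.pow b)

theorem integrable_comp_complexGaussian {v : ℝ≥0} {f : ℂ → ℂ} (hm : Measurable f)
    (hf : Integrable f (complexGaussian v)) :
    Integrable (fun p : ℝ × ℝ => f (p.1 + p.2 * Complex.I))
      ((gaussianReal 0 (v / 2)).prod (gaussianReal 0 (v / 2))) := by
  rw [complexGaussian, integrable_map_measure hm.aestronglyMeasurable (by fun_prop)] at hf
  exact hf

theorem integral_complexGaussian (v : ℝ≥0) {f : ℂ → ℂ} (hm : Measurable f) :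
    ∫ z, f z ∂complexGaussian v = ∫ p : ℝ × ℝ, f (p.1 + p.2 * Complex.I)
      ∂((gaussianReal 0 (v / 2)).prod (gaussianReal 0 (v / 2))) := by
  rw [complexGaussian, integral_map (by fun_prop) hm.aestronglyMeasurable]

theorem integral_re_mul_complexGaussian (v : ℝ≥0) (a b : ℕ) :
    ∫ z, (z.re : ℂ) * (z ^ a * conj z ^ b) ∂complexGaussian v
      = v / 2 * (a * gaussianMoment v (a - 1) b + b * gaussianMoment v a (b - 1)) := by
  have hI (a b : ℕ) := (hasAllMoments_pow_mul_complexGaussian v a b).integrable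
  have hI1 : Integrable (fun z : ℂ => (z.re : ℂ) * (z ^ a * conj z ^ b)) (complexGaussian v) := by
    convert ((hI (a + 1) b).add (hI a (b + 1))).const_mul (1 / 2 : ℂ) using 1
    ext z
    simp only [Pi.add_apply, Complex.re_eq_add_conj]
    ring
  have hI2 : Integrable (fun z : ℂ => (a * (z ^ (a - 1) * conj z ^ b)
      + b * (z ^ a * conj z ^ (b - 1)) : ℂ)) (complexGaussian v) :=
    ((hI (a - 1) b).const_mul _).add ((hI a (b - 1)).const_mul _)
  have key : a * gaussianMoment v (a - 1) b + b * gaussianMoment v a (b - 1)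
      = ∫ z, (a * (z ^ (a - 1) * conj z ^ b) + b * (z ^ a * conj z ^ (b - 1)) : ℂ)
        ∂complexGaussian v := by
    rw [integral_add ((hI (a - 1) b).const_mul _) ((hI a (b - 1)).const_mul _),
      integral_const_mul, integral_const_mul]
    rfl
  rw [key, integral_complexGaussian v (by fun_prop), integral_complexGaussian v (by fun_prop),
    -- With the imaginary part frozen by Fubini, the integrand is a polynomial in the real part, to
    -- which Stein's identity applies.
    integral_prod_symm _ (integrable_comp_complexGaussian (by fun_prop) hI1),
    integral_prod_symm _ (integrable_comp_complexGaussian (by fun_prop) hI2),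
    ← integral_const_mul]
  refine integral_congr_ae (ae_of_all _ fun y => ?_)
  have h := integral_mul_eval_gaussianReal (v / 2)
    ((Polynomial.X + Polynomial.C (y * Complex.I)) ^ a
      * (Polynomial.X + Polynomial.C (-(y * Complex.I))) ^ b)
  simp only [Polynomial.derivative_mul, Polynomial.derivative_X_add_C_pow, Polynomial.eval_add,
    Polynomial.eval_mul, Polynomial.eval_pow, Polynomial.eval_X, Polynomial.eval_C] at h
  have hc : ((v / 2 : ℝ≥0) : ℂ) = (v : ℂ) / 2 := by push_cast; rfl
  rw [← hc]
  convert h using 2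
  · ext x; simp
  · congr 1
    ext x; simp; ring

theorem integral_im_mul_complexGaussian (v : ℝ≥0) (a b : ℕ) :
    ∫ z, (z.im : ℂ) * (z ^ a * conj z ^ b) ∂complexGaussian v
      = v / 2 * (Complex.I *
        (a * gaussianMoment v (a - 1) b - b * gaussianMoment v a (b - 1))) := by
  have hI (a b : ℕ) := (hasAllMoments_pow_mul_complexGaussian v a b).integrable
  have hI1 : Integrable (fun z : ℂ => (z.im : ℂ) * (z ^ a * conj z ^ b)) (complexGaussian v) := by
    convert ((hI (a + 1) b).sub (hI a (b + 1))).const_mul (1 / (2 * Complex.I) : ℂ) using 1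
    ext z
    simp only [Pi.sub_apply, Complex.im_eq_sub_conj]
    ring
  have hI2 : Integrable (fun z : ℂ => (a * (z ^ (a - 1) * conj z ^ b)
      - b * (z ^ a * conj z ^ (b - 1)) : ℂ)) (complexGaussian v) :=
    ((hI (a - 1) b).const_mul _).sub ((hI a (b - 1)).const_mul _)
  have key : a * gaussianMoment v (a - 1) b - b * gaussianMoment v a (b - 1)
      = ∫ z, (a * (z ^ (a - 1) * conj z ^ b) - b * (z ^ a * conj z ^ (b - 1)) : ℂ)
        ∂complexGaussian v := by
    rw [integral_sub ((hI (a - 1) b).const_mul _) ((hI a (b - 1)).const_mul _),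
      integral_const_mul, integral_const_mul]
    rfl
  rw [key, integral_complexGaussian v (by fun_prop), integral_complexGaussian v (by fun_prop),
    integral_prod _ (integrable_comp_complexGaussian (by fun_prop) hI1),
    integral_prod _ (integrable_comp_complexGaussian (by fun_prop) hI2),
    ← integral_const_mul, ← integral_const_mul]
  refine integral_congr_ae (ae_of_all _ fun x => ?_)
  have h := integral_mul_eval_gaussianReal (v / 2)
    ((Polynomial.C Complex.I * Polynomial.X + Polynomial.C (x : ℂ)) ^ a
      * (Polynomial.C (-Complex.I) * Polynomial.X + Polynomial.C (x : ℂ)) ^ b)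
  simp only [Polynomial.derivative_mul, Polynomial.derivative_pow, Polynomial.eval_add,
    Polynomial.eval_mul, Polynomial.eval_pow, Polynomial.eval_X, Polynomial.eval_C,
    Polynomial.derivative_add, Polynomial.derivative_C, Polynomial.derivative_X] at h
  have hc : ((v / 2 : ℝ≥0) : ℂ) = (v : ℂ) / 2 := by push_cast; rfl
  rw [← hc]
  convert h using 2
  · ext y; simp only [Complex.add_im, Complex.ofReal_im, Complex.mul_im, Complex.ofReal_re,
      Complex.I_im, Complex.I_re, map_add, map_mul, Complex.conj_ofReal, Complex.conj_I]
    congr 1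
    · simp
    · ring
  · rw [← integral_const_mul]
    congr 1
    ext y; simp; ring

/-- Write `z = re + I · im` and apply Stein in each coordinate: the derivatives in `z` cancel and
those in `conj z` add up. The truncated `b - 1` is harmless because of the factor `b`. -/
theorem gaussianMoment_succ_left (v : ℝ≥0) (a b : ℕ) :
    gaussianMoment v (a + 1) b = v * (b * gaussianMoment v a (b - 1)) := by
  have hI (a b : ℕ) := (hasAllMoments_pow_mul_complexGaussian v a b).integrable
  have hI1 : Integrable (fun z : ℂ => (z.re : ℂ) * (z ^ a * conj z ^ b)) (complexGaussian v) := by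
    convert ((hI (a + 1) b).add (hI a (b + 1))).const_mul (1 / 2 : ℂ) using 1
    ext z
    simp only [Pi.add_apply, Complex.re_eq_add_conj]
    ring
  have hI2 : Integrable (fun z : ℂ => (z.im : ℂ) * (z ^ a * conj z ^ b)) (complexGaussian v) := by
    convert ((hI (a + 1) b).sub (hI a (b + 1))).const_mul (1 / (2 * Complex.I) : ℂ) using 1
    ext z
    simp only [Pi.sub_apply, Complex.im_eq_sub_conj]
    ring
  have h : gaussianMoment v (a + 1) b
      = ∫ z, (z.re : ℂ) * (z ^ a * conj z ^ b) + Complex.I * ((z.im : ℂ) * (z ^ a * conj z ^ b))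
        ∂complexGaussian v := by
    unfold gaussianMoment
    congr 1
    ext z
    conv_lhs => rw [pow_succ', mul_assoc, ← Complex.re_add_im z]
    rw [Complex.re_add_im]
    conv_lhs => enter [1]; rw [← Complex.re_add_im z]
    ring
  rw [h, integral_add hI1 (hI2.const_mul _), integral_const_mul, integral_re_mul_complexGaussian,
    integral_im_mul_complexGaussian]
  linear_combination (v : ℂ) / 2 * (a * gaussianMoment v (a - 1) b - b * gaussianMoment v a (b - 1))
    * Complex.I_mul_I

theorem gaussianMoment_conj (v : ℝ≥0) (a b : ℕ) :
    gaussianMoment v a b = conj (gaussianMoment v b a) := by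
  unfold gaussianMoment
  rw [← integral_conj]
  congr 1
  ext z
  simp [mul_comm]

theorem gaussianMoment_succ_right (v : ℝ≥0) (a b : ℕ) :
    gaussianMoment v a (b + 1) = v * (a * gaussianMoment v (a - 1) b) := by
  rw [gaussianMoment_conj, gaussianMoment_succ_left]
  simp [gaussianMoment_conj v (a - 1) b]

theorem gaussianMoment_eq (v : ℝ≥0) (a b : ℕ) :
    gaussianMoment v a b = if a = b then (a.factorial : ℂ) * (v : ℂ) ^ a else 0 := by
  induction a generalizing b with
  | zero =>
    cases b with
    | zero => simp [gaussianMoment]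
    | succ b => rw [gaussianMoment_succ_right]; simp
  | succ a ih =>
    rw [gaussianMoment_succ_left]
    cases b with
    | zero => simp
    | succ b =>
      rw [Nat.add_sub_cancel, ih]
      by_cases h : a = b
      · subst h
        simp [Nat.factorial_succ]; ring
      · simp [h]

end ComplexGaussian

/-! ### Integration by parts for polynomials in independent complex Gaussians -/

section PolynomialExpectation

variable {ι : Type*} {Ω : Type*} [MeasurableSpace Ω]

/-- The values of the formal variables `Z_p` (index `(p, false)`) and `conj Z_p`
(index `(p, true)`). -/
def conjVars (Z : ι → Ω → ℂ) (ω : Ω) (s : ι × Bool) : ℂ :=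
  if s.2 then conj (Z s.1 ω) else Z s.1 ω

/-- The expectation of a polynomial in the variables `Z_p` and `conj Z_p`. -/
noncomputable def polyExp (μ : Measure Ω) (Z : ι → Ω → ℂ) (Q : MvPolynomial (ι × Bool) ℂ) : ℂ :=
  ∫ ω, MvPolynomial.aeval (conjVars Z ω) Q ∂μ

variable {μ : Measure Ω} {Z : ι → Ω → ℂ} {v : ℝ≥0}

theorem hasAllMoments_of_hasLaw {X : Ω → ℂ} (h : HasLaw X (complexGaussian v) μ) :
    HasAllMoments X μ := fun p => by
  have h1 := hasAllMoments_complexGaussian v p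
  rw [← h.map_eq, memLp_map_measure_iff (by fun_prop) h.aemeasurable] at h1
  exact h1

theorem hasAllMoments_aeval [IsFiniteMeasure μ] (hlaw : ∀ p, HasLaw (Z p) (complexGaussian v) μ)
    (Q : MvPolynomial (ι × Bool) ℂ) :
    HasAllMoments (fun ω => MvPolynomial.aeval (conjVars Z ω) Q) μ := by
  induction Q using MvPolynomial.induction_on with
  | C a => simpa using hasAllMoments_const a
  | add p q hp hq => simpa using hp.add hq
  | mul_X p s hp =>
    simp only [map_mul, MvPolynomial.aeval_X]
    refine hp.mul ?_
    rcases s with ⟨p, _ | _⟩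
    · simpa [conjVars] using hasAllMoments_of_hasLaw (hlaw p)
    · simpa [conjVars] using (hasAllMoments_of_hasLaw (hlaw p)).star

theorem integrable_aeval [IsFiniteMeasure μ] (hlaw : ∀ p, HasLaw (Z p) (complexGaussian v) μ)
    (Q : MvPolynomial (ι × Bool) ℂ) :
    Integrable (fun ω => MvPolynomial.aeval (conjVars Z ω) Q) μ :=
  (hasAllMoments_aeval hlaw Q).integrable

theorem polyExp_add [IsFiniteMeasure μ] (hlaw : ∀ p, HasLaw (Z p) (complexGaussian v) μ)
    (Q R : MvPolynomial (ι × Bool) ℂ) :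
    polyExp μ Z (Q + R) = polyExp μ Z Q + polyExp μ Z R := by
  simp only [polyExp, map_add]
  exact integral_add (integrable_aeval hlaw Q) (integrable_aeval hlaw R)

theorem polyExp_C_mul (c : ℂ) (Q : MvPolynomial (ι × Bool) ℂ) :
    polyExp μ Z (MvPolynomial.C c * Q) = c * polyExp μ Z Q := by
  simp only [polyExp, map_mul, MvPolynomial.aeval_C]
  exact integral_const_mul _ _

theorem polyExp_one [IsProbabilityMeasure μ] : polyExp μ Z 1 = 1 := by simp [polyExp]

theorem polyExp_monomial (hind : iIndepFun Z μ)
    (hlaw : ∀ p, HasLaw (Z p) (complexGaussian v) μ) (s : ι × Bool →₀ ℕ) (T : Finset ι)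
    (hT : ∀ x ∈ s.support, x.1 ∈ T) :
    polyExp μ Z (MvPolynomial.monomial s 1)
      = ∏ p ∈ T, gaussianMoment v (s (p, false)) (s (p, true)) := by
  have h1 : ∀ ω, MvPolynomial.aeval (conjVars Z ω) (MvPolynomial.monomial s (1 : ℂ))
      = ∏ p : T, (Z p ω ^ s (p, false) * conj (Z p ω) ^ s (p, true)) := fun ω => by
    rw [MvPolynomial.aeval_monomial, map_one, one_mul,
      Finsupp.prod_of_support_subset s (s := T ×ˢ Finset.univ) (fun x hx => by simp [hT x hx]) _
        (fun _ _ => pow_zero _), Finset.prod_product,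
      ← Finset.prod_coe_sort T]
    exact Finset.prod_congr rfl fun p _ => by simp [conjVars, mul_comm]
  simp only [polyExp, h1]
  have hind' : iIndepFun (fun p : T => Z p) μ := hind.precomp Subtype.val_injective
  have := iIndepFun.integral_fun_prod_comp (X := fun p : T => Z p) (𝕜 := ℂ) hind'
    (f := fun p z => z ^ s (p, false) * conj z ^ s (p, true))
    (fun p => (hlaw p).aemeasurable) (fun p => by fun_prop)
  rw [this, ← Finset.prod_coe_sort T]
  refine Finset.prod_congr rfl fun p _ => ?_
  rw [gaussianMoment, ← (hlaw p).map_eq, integral_map (hlaw p).aemeasurable (by fun_prop)]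

/-- Gaussian integration by parts for polynomials in independent complex Gaussian variables and
their conjugates. -/
theorem polyExp_X_mul (hind : iIndepFun Z μ)
    (hlaw : ∀ p, HasLaw (Z p) (complexGaussian v) μ) (p : ι) (e : Bool)
    (Q : MvPolynomial (ι × Bool) ℂ) :
    polyExp μ Z (MvPolynomial.X (p, e) * Q) = v * polyExp μ Z (MvPolynomial.pderiv (p, !e) Q) := by
  classical
  have := hind.isProbabilityMeasure
  induction Q using MvPolynomial.induction_on' with
  | add P Q hP hQ =>
    rw [mul_add, polyExp_add hlaw, hP, hQ, map_add, polyExp_add hlaw, mul_add]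
  | monomial s c =>
    have h1 : MvPolynomial.X (p, e) * MvPolynomial.monomial s c
        = MvPolynomial.C c * MvPolynomial.monomial (Finsupp.single (p, e) 1 + s) 1 := by
      rw [MvPolynomial.X, MvPolynomial.monomial_mul, MvPolynomial.C_mul_monomial, one_mul, mul_one]
    have h2 : MvPolynomial.pderiv (p, !e) (MvPolynomial.monomial s c)
        = MvPolynomial.C (c * s (p, !e))
          * MvPolynomial.monomial (s - Finsupp.single (p, !e) 1) 1 := by
      rw [MvPolynomial.pderiv_monomial, MvPolynomial.C_mul_monomial, mul_one]
    -- One index set for both monomials, so that the two products of moments differ only in the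
    -- factor at `p`.
    let T : Finset ι := insert p (s.support.image Prod.fst)
    have hp : p ∈ T := Finset.mem_insert_self _ _
    have hT : ∀ x ∈ s.support, x.1 ∈ T := fun x hx =>
      Finset.mem_insert_of_mem (Finset.mem_image_of_mem _ hx)
    rw [h1, h2, polyExp_C_mul, polyExp_C_mul, polyExp_monomial hind hlaw _ T,
      polyExp_monomial hind hlaw _ T, ← Finset.mul_prod_erase T _ hp,
      ← Finset.mul_prod_erase T _ hp]
    · have h3 : ∏ q ∈ T.erase p, gaussianMoment v ((Finsupp.single (p, e) 1 + s : ι × Bool →₀ ℕ) (q, false))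
            ((Finsupp.single (p, e) 1 + s : ι × Bool →₀ ℕ) (q, true))
          = ∏ q ∈ T.erase p, gaussianMoment v ((s - Finsupp.single (p, !e) 1 : ι × Bool →₀ ℕ) (q, false))
            ((s - Finsupp.single (p, !e) 1 : ι × Bool →₀ ℕ) (q, true)) := by
        refine Finset.prod_congr rfl fun q hq => ?_
        have hq' : p ≠ q := (Finset.ne_of_mem_erase hq).symm
        simp [hq']
      rw [h3]
      generalize ∏ q ∈ T.erase p, gaussianMoment v ((s - Finsupp.single (p, !e) 1 : ι × Bool →₀ ℕ) (q, false))
            ((s - Finsupp.single (p, !e) 1 : ι × Bool →₀ ℕ) (q, true)) = r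
      cases e
      · simp [add_comm 1, gaussianMoment_succ_left]; ring
      · simp [add_comm 1, gaussianMoment_succ_right]; ring
    · intro x hx
      apply hT x
      simp only [Finsupp.mem_support_iff, Finsupp.coe_tsub, Pi.sub_apply] at hx ⊢
      omega
    · intro x hx
      by_cases hx' : x = (p, e)
      · subst hx'; exact hp
      · apply hT x
        simpa [Finsupp.single_apply, Ne.symm hx'] using hx

end PolynomialExpectation

/-! ### Words in matrices and adjoints, and their splittings at a letter -/

section Words

/-- Words in the letters `(r, false)` (for `G_r`) and `(r, true)` (for `G_r^*`). -/
abbrev StarWord := List (ℕ × Bool)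

/-- The adjoint letter. -/
def adjointLetter (x : ℕ × Bool) : ℕ × Bool := (x.1, !x.2)

/-- The sum of `f a b` over all the decompositions `V = a z b`. -/
def splitSum {M : Type*} [AddCommMonoid M] (z : ℕ × Bool) (V : StarWord)
    (f : StarWord → StarWord → M) : M :=
  ∑ q ∈ Finset.range V.length, if V[q]? = some z then f (V.take q) (V.drop (q + 1)) else 0

variable {M : Type*} [AddCommMonoid M]

@[simp]
theorem splitSum_nil (z : ℕ × Bool) (f : StarWord → StarWord → M) : splitSum z [] f = 0 := by
  simp [splitSum]

theorem splitSum_cons (z x : ℕ × Bool) (V : StarWord) (f : StarWord → StarWord → M) :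
    splitSum z (x :: V) f
      = (if x = z then f [] V else 0) + splitSum z V (fun a b => f (x :: a) b) := by
  simp [splitSum, Finset.sum_range_succ', add_comm]

theorem splitSum_append (z : ℕ × Bool) (V W : StarWord) (f : StarWord → StarWord → M) :
    splitSum z (V ++ W) f
      = splitSum z V (fun a b => f a (b ++ W)) + splitSum z W (fun a b => f (V ++ a) b) := by
  induction V generalizing f with
  | nil => simp
  | cons x V ih => simp [splitSum_cons, ih, add_assoc]

theorem splitSum_eq_zero {z : ℕ × Bool} {V : StarWord} (h : z ∉ V)
    (f : StarWord → StarWord → M) : splitSum z V f = 0 := by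
  refine Finset.sum_eq_zero fun q _ => if_neg fun hq => h ?_
  exact List.mem_of_getElem? hq

theorem map_splitSum {M' F : Type*} [AddCommMonoid M'] [FunLike F M M'] [AddMonoidHomClass F M M']
    (φ : F) (z : ℕ × Bool) (V : StarWord) (f : StarWord → StarWord → M) :
    φ (splitSum z V f) = splitSum z V fun a b => φ (f a b) := by
  simp only [splitSum, map_sum, apply_ite φ, map_zero]

theorem splitSum_mul {R : Type*} [Semiring R] (z : ℕ × Bool) (V : StarWord)
    (f : StarWord → StarWord → R) (r : R) :
    splitSum z V f * r = splitSum z V fun a b => f a b * r := by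
  simp only [splitSum, Finset.sum_mul, ite_mul, zero_mul]

theorem mul_splitSum {R : Type*} [Semiring R] (z : ℕ × Bool) (V : StarWord)
    (f : StarWord → StarWord → R) (r : R) :
    r * splitSum z V f = splitSum z V fun a b => r * f a b := by
  simp only [splitSum, Finset.mul_sum, mul_ite, mul_zero]

theorem splitSum_mem {R : Type*} [Semiring R] [Module R M] (S : Submodule R M) (z : ℕ × Bool)
    (V : StarWord) (f : StarWord → StarWord → M)
    (h : ∀ a b : StarWord, a.length + b.length + 1 = V.length → f a b ∈ S) :
    splitSum z V f ∈ S := by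
  refine S.sum_mem fun q hq => ?_
  split_ifs
  · refine h _ _ ?_
    have := Finset.mem_range.1 hq
    simp; omega
  · exact S.zero_mem

end Words

/-! ### The loop equation, for entries and for formal trace polynomials -/

section LoopEquation

open MvPolynomial

/-- Polynomials in the entries of the matrices `G_r` and their conjugates. -/
abbrev EntryPoly (N : ℕ) := MvPolynomial ((ℕ × Fin N × Fin N) × Bool) ℂ

/-- The variable for the entry `(i, j)` of the matrix named by the letter `x`. -/
def entryVar {N : ℕ} (x : ℕ × Bool) (i j : Fin N) : (ℕ × Fin N × Fin N) × Bool :=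
  if x.2 then ((x.1, j, i), true) else ((x.1, i, j), false)

theorem entryVar_eq_iff {N : ℕ} (x y : ℕ × Bool) (i j a b : Fin N) :
    entryVar x i j = entryVar y a b ↔ x = y ∧ i = a ∧ j = b := by
  rcases x with ⟨r, _ | _⟩ <;> rcases y with ⟨s, _ | _⟩ <;> simp [entryVar]
  tauto

/-- The generic matrix of a letter. -/
noncomputable def letterMatrix (N : ℕ) (x : ℕ × Bool) : Matrix (Fin N) (Fin N) (EntryPoly N) :=
  Matrix.of fun i j => X (entryVar x i j)

/-- The generic matrix of a word. -/
noncomputable def starWordMatrix (N : ℕ) (W : StarWord) : Matrix (Fin N) (Fin N) (EntryPoly N) :=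
  (W.map (letterMatrix N)).prod

@[simp]
theorem starWordMatrix_nil (N : ℕ) : starWordMatrix N [] = 1 := rfl

theorem starWordMatrix_cons (N : ℕ) (x : ℕ × Bool) (W : StarWord) :
    starWordMatrix N (x :: W) = letterMatrix N x * starWordMatrix N W := by
  simp [starWordMatrix]

theorem starWordMatrix_append (N : ℕ) (V W : StarWord) :
    starWordMatrix N (V ++ W) = starWordMatrix N V * starWordMatrix N W := by
  simp [starWordMatrix]

/-- Leibniz: differentiating an occurrence of `z` cuts the word there. Entries of `G` and of its
adjoint count as distinct variables. -/
theorem pderiv_starWordMatrix {N : ℕ} (z : ℕ × Bool) (i j a b : Fin N) (V : StarWord) :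
    pderiv (entryVar z j i) (starWordMatrix N V a b)
      = splitSum z V fun V₁ V₂ => starWordMatrix N V₁ a j * starWordMatrix N V₂ i b := by
  induction V generalizing a with
  | nil =>
    simp only [starWordMatrix_nil, splitSum_nil, Matrix.one_apply]
    split_ifs <;> simp
  | cons x V ih =>
    simp only [starWordMatrix_cons, Matrix.mul_apply, map_sum, Derivation.leibniz, smul_eq_mul,
      splitSum_cons, ih, Finset.sum_add_distrib, starWordMatrix_nil]
    rw [add_comm]
    congr 1
    · simp only [letterMatrix, Matrix.of_apply, pderiv_X, Pi.single_apply, entryVar_eq_iff]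
      by_cases hx : x = z
      · subst hx
        by_cases ha : a = j
        · subst ha; simp
        · simp [ha]
      · simp [hx]
    · simp only [mul_splitSum, Finset.sum_mul]
      unfold splitSum
      rw [Finset.sum_comm]
      refine Finset.sum_congr rfl fun q _ => ?_
      split_ifs
      · exact Finset.sum_congr rfl fun c _ => by ring
      · simp

/-- The derivation `R ↦ ∑ W_{ji} ∂_{ij} R` appearing in the loop equation. -/
noncomputable def loopDeriv (N : ℕ) (x : ℕ × Bool) (W : StarWord) :
    Derivation ℂ (EntryPoly N) (EntryPoly N) :=
  ∑ i, ∑ j, starWordMatrix N W j i • pderiv (entryVar (adjointLetter x) j i)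

theorem loopDeriv_apply (N : ℕ) (x : ℕ × Bool) (W : StarWord) (R : EntryPoly N) :
    loopDeriv N x W R
      = ∑ i, ∑ j, starWordMatrix N W j i * pderiv (entryVar (adjointLetter x) j i) R := by
  simp only [loopDeriv, ← Derivation.coeFnAddMonoidHom_apply, map_sum, Finset.sum_apply]
  rfl

/-- Differentiation opens the cyclic word `V` at the adjoint letter, and the weights from `W` glue
`W` into the gap. -/
theorem loopDeriv_trace (N : ℕ) (x : ℕ × Bool) (W V : StarWord) :
    loopDeriv N x W (starWordMatrix N V).trace
      = splitSum (adjointLetter x) V fun a b => (starWordMatrix N (W ++ b ++ a)).trace := by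
  simp only [loopDeriv_apply, Matrix.trace, Matrix.diag, map_sum, pderiv_starWordMatrix,
    starWordMatrix_append]
  unfold splitSum
  simp only [Finset.mul_sum]
  refine (Finset.sum_congr rfl fun c _ => (Finset.sum_congr rfl fun i _ =>
    Finset.sum_comm).trans Finset.sum_comm).trans Finset.sum_comm |>.trans ?_
  refine Finset.sum_congr rfl fun q _ => ?_
  split_ifs
  · simp only [Matrix.mul_apply, Finset.sum_mul]
    rw [Finset.sum_comm (s := Finset.univ (α := Fin N))]
    conv_rhs => rw [Finset.sum_comm]
    rw [Finset.sum_comm]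
    refine Finset.sum_congr rfl fun c _ => ?_
    rw [Finset.sum_comm]
    exact Finset.sum_congr rfl fun j _ => Finset.sum_congr rfl fun i _ => by ring
  · simp

/-- A linear functional on entry polynomials satisfying the integration by parts formula of
complex Gaussian entries of variance `1 / N`. -/
structure IsGinibreFunctional {N : ℕ} (E : EntryPoly N →ₗ[ℂ] ℂ) : Prop where
  map_one : E 1 = 1
  map_X_mul : ∀ (x : ℕ × Bool) (i j : Fin N) (Q : EntryPoly N),
    E (X (entryVar x i j) * Q) = (N : ℂ)⁻¹ * E (pderiv (entryVar (adjointLetter x) j i) Q)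

/-- The loop (Schwinger–Dyson) equation. -/
theorem IsGinibreFunctional.loop_equation {N : ℕ} {E : EntryPoly N →ₗ[ℂ] ℂ}
    (hE : IsGinibreFunctional E) (x : ℕ × Bool) (W : StarWord) (R : EntryPoly N) :
    E ((starWordMatrix N (x :: W)).trace * R) = (N : ℂ)⁻¹ *
      (E ((splitSum (adjointLetter x) W fun a b =>
        (starWordMatrix N a).trace * (starWordMatrix N b).trace) * R) + E (loopDeriv N x W R)) := by
  have h1 : (starWordMatrix N (x :: W)).trace * R
      = ∑ i, ∑ j, X (entryVar x i j) * (starWordMatrix N W j i * R) := by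
    simp only [starWordMatrix_cons, Matrix.trace, Matrix.diag, Matrix.mul_apply, Finset.sum_mul,
      letterMatrix, Matrix.of_apply, mul_assoc]
  simp only [h1, map_sum, hE.map_X_mul]
  simp only [← Finset.mul_sum, ← map_sum, ← map_add]
  congr 2
  simp only [Derivation.leibniz, pderiv_starWordMatrix, smul_eq_mul, Finset.sum_add_distrib,
    loopDeriv_apply]
  rw [add_comm]
  congr 1
  simp only [mul_comm R, ← Finset.sum_mul]
  congr 1
  unfold splitSum
  calc _ = ∑ i, ∑ q ∈ Finset.range W.length, ∑ j, (if W[q]? = some (adjointLetter x) then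
              starWordMatrix N (W.take q) j j * starWordMatrix N (W.drop (q + 1)) i i else 0) :=
        Finset.sum_congr rfl fun i _ => Finset.sum_comm
    _ = _ := by
        rw [Finset.sum_comm]
        refine Finset.sum_congr rfl fun q _ => ?_
        split_ifs
        · simp only [Matrix.trace, Matrix.diag, Finset.sum_mul_sum]
          rw [Finset.sum_comm]
        · simp

/-- Formal polynomials in normalized traces of words. -/
abbrev TracePoly := MvPolynomial StarWord ℂ

/-- The evaluation of a trace polynomial at normalized traces of `N × N` matrices. -/
noncomputable def traceEval (N : ℕ) : TracePoly →ₐ[ℂ] EntryPoly N :=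
  aeval fun W => C (N : ℂ)⁻¹ * (starWordMatrix N W).trace

/-- The formal counterpart of `loopDeriv`. -/
noncomputable def formalLoopDeriv (x : ℕ × Bool) (W : StarWord) :
    Derivation ℂ TracePoly TracePoly :=
  mkDerivation ℂ fun V => splitSum (adjointLetter x) V fun a b => X (W ++ b ++ a)

/-- The splitting term of the loop equation. -/
noncomputable def splitPoly (x : ℕ × Bool) (W : StarWord) : TracePoly :=
  splitSum (adjointLetter x) W fun a b => X a * X b

theorem traceEval_X (N : ℕ) (W : StarWord) :
    traceEval N (X W) = C (N : ℂ)⁻¹ * (starWordMatrix N W).trace := by simp [traceEval]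

/-- No power of `N` appears: gluing turns one normalized trace into one normalized trace. Hence the
correction in the loop equation really is of order `N⁻²`. -/
theorem loopDeriv_traceEval (N : ℕ) (x : ℕ × Bool) (W : StarWord) (Q : TracePoly) :
    loopDeriv N x W (traceEval N Q) = traceEval N (formalLoopDeriv x W Q) := by
  induction Q using MvPolynomial.induction_on with
  | C a => simp [← MvPolynomial.algebraMap_eq]
  | add p q hp hq => simp only [map_add, hp, hq]
  | mul_X p V hp =>
    have h : loopDeriv N x W (traceEval N (X V)) = traceEval N (formalLoopDeriv x W (X V)) := by
      rw [traceEval_X, Derivation.leibniz, loopDeriv_trace, formalLoopDeriv, mkDerivation_X,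
        map_splitSum]
      simp only [traceEval_X, ← mul_splitSum, smul_eq_mul]
      simp [← MvPolynomial.algebraMap_eq]
    rw [map_mul, Derivation.leibniz, Derivation.leibniz, hp, h]
    simp

theorem IsGinibreFunctional.loop_equation_traceEval {N : ℕ}
    {E : EntryPoly N →ₗ[ℂ] ℂ} (hE : IsGinibreFunctional E) (x : ℕ × Bool) (W : StarWord)
    (R : EntryPoly N) :
    E (traceEval N (X (x :: W)) * R)
      = E (traceEval N (splitPoly x W) * R) + (N : ℂ)⁻¹ ^ 2 * E (loopDeriv N x W R) := by
  have hC : ∀ (c : ℂ) (Q : EntryPoly N), E (C c * Q) = c * E Q := fun c Q => by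
    rw [← smul_eq_C_mul, map_smul, smul_eq_mul]
  have h : traceEval N (splitPoly x W) * R = C ((N : ℂ)⁻¹ ^ 2) *
      ((splitSum (adjointLetter x) W fun a b =>
        (starWordMatrix N a).trace * (starWordMatrix N b).trace) * R) := by
    rw [splitPoly, map_splitSum, ← mul_assoc, mul_splitSum]
    congr 2
    ext1 a; ext1 b
    rw [map_mul, traceEval_X, traceEval_X, map_pow]
    ring
  rw [traceEval_X, mul_assoc, hC, hE.loop_equation, h, hC]
  ring

end LoopEquation

/-! ### Convergence and asymptotic factorization of expected normalized traces -/

section Limit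

open MvPolynomial

/-- The limit of the expected normalized trace of a word. -/
noncomputable def limitTrace : StarWord → ℂ
  | [] => 1
  | x :: W => ∑ q ∈ Finset.range W.length,
      if W[q]? = some (adjointLetter x) then limitTrace (W.take q) * limitTrace (W.drop (q + 1))
      else 0
  termination_by W => W.length
  decreasing_by all_goals (simp only [List.length_take, List.length_drop, List.length_cons]; omega)

theorem limitTrace_nil : limitTrace [] = 1 := by rw [limitTrace]

theorem limitTrace_cons (x : ℕ × Bool) (W : StarWord) :
    limitTrace (x :: W)
      = splitSum (adjointLetter x) W fun a b => limitTrace a * limitTrace b := by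
  rw [limitTrace]; rfl

/-- The limit of the expectation of a trace polynomial. -/
noncomputable def limitEval : TracePoly →ₐ[ℂ] ℂ := aeval limitTrace

theorem limitEval_X (W : StarWord) : limitEval (X W) = limitTrace W := by simp [limitEval]

theorem limitEval_splitPoly (x : ℕ × Bool) (W : StarWord) :
    limitEval (splitPoly x W) = limitEval (X (x :: W)) := by
  simp only [splitPoly, map_splitSum, map_mul, limitEval_X, limitTrace_cons]

variable {E : ∀ N, EntryPoly N →ₗ[ℂ] ℂ}

/-- The trace polynomials `Q` whose expectation converges to `limitEval Q`. -/
noncomputable def limitSubmodule (E : ∀ N, EntryPoly N →ₗ[ℂ] ℂ) : Submodule ℂ TracePoly where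
  carrier := {Q | Tendsto (fun N => E N (traceEval N Q)) atTop (𝓝 (limitEval Q))}
  add_mem' {P Q} hP hQ := by simpa using Filter.Tendsto.add hP hQ
  zero_mem' := by simp
  smul_mem' c Q hQ := by simpa using Filter.Tendsto.const_mul c hQ

theorem mem_limitSubmodule {Q : TracePoly} : Q ∈ limitSubmodule E ↔
    Tendsto (fun N => E N (traceEval N Q)) atTop (𝓝 (limitEval Q)) := Iff.rfl

/-- The monomial attached to a list of words. -/
noncomputable def wordsPoly (L : List StarWord) : TracePoly := (L.map X).prod

theorem wordsPoly_cons (V : StarWord) (L : List StarWord) :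
    wordsPoly (V :: L) = X V * wordsPoly L := by simp [wordsPoly]

theorem wordsPoly_append (K L : List StarWord) :
    wordsPoly (K ++ L) = wordsPoly K * wordsPoly L := by simp [wordsPoly]

theorem traceEval_X_nil {N : ℕ} (hN : N ≠ 0) : traceEval N (X []) = 1 := by
  have hN' : (N : ℂ) ≠ 0 := by exact_mod_cast hN
  rw [traceEval_X, starWordMatrix_nil, Matrix.trace_one, Fintype.card_fin]
  rw [show ((N : EntryPoly N)) = C (N : ℂ) by simp, ← C_mul, inv_mul_cancel₀ hN', C_1]

/-- The total length of a list of words. -/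
def totalLength (L : List StarWord) : ℕ := (L.map List.length).sum

/-- Leibniz along the list, with `K` collecting the factors already passed over. Gluing `W` into `V`
consumes one letter of `V`, so every resulting monomial stays below length `n`. -/
theorem wordsPoly_mul_formalLoopDeriv_mem (n : ℕ)
    (ih : ∀ L, totalLength L < n → wordsPoly L ∈ limitSubmodule E) (x : ℕ × Bool)
    (W : StarWord) (K L : List StarWord)
    (h : W.length + totalLength K + totalLength L < n) :
    wordsPoly K * formalLoopDeriv x W (wordsPoly L) ∈ limitSubmodule E := by
  induction L generalizing K with
  | nil => simp [wordsPoly]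
  | cons V L ihL =>
    simp only [totalLength, List.map_cons, List.sum_cons] at h ihL
    rw [wordsPoly_cons, Derivation.leibniz, mul_add]
    refine Submodule.add_mem _ ?_ ?_
    · have := ihL (V :: K) (by simp; omega)
      rw [wordsPoly_cons] at this
      convert this using 1
      simp; ring
    · rw [formalLoopDeriv, mkDerivation_X, smul_eq_mul, ← mul_assoc, mul_splitSum]
      refine splitSum_mem _ _ _ _ fun a b hab => ?_
      have := ih ((W ++ b ++ a) :: (K ++ L)) (by simp [totalLength]; omega)
      rw [wordsPoly_cons, wordsPoly_append] at this
      rwa [mul_comm]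

theorem wordsPoly_mem (hE : ∀ N, IsGinibreFunctional (E N)) (L : List StarWord) :
    wordsPoly L ∈ limitSubmodule E := by
  induction hn : totalLength L using Nat.strong_induction_on generalizing L with
  | _ n ih =>
  subst hn
  induction L with
  | nil => simp [wordsPoly, mem_limitSubmodule, (hE _).map_one]
  | cons V L ihL =>
    cases V with
    | nil =>
      -- Deleting an empty word leaves the total length unchanged, hence the inner induction on the
      -- list.
      have h := ihL fun m hm K hK => ih m (by simpa [totalLength] using hm) K hK
      rw [mem_limitSubmodule] at h ⊢
      rw [wordsPoly_cons, map_mul, limitEval_X, limitTrace_nil, one_mul]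
      refine h.congr' ?_
      filter_upwards [eventually_ne_atTop 0] with N hN
      rw [map_mul, traceEval_X_nil hN, one_mul]
    | cons x W =>
      have ih' : ∀ K, totalLength K < totalLength ((x :: W) :: L) →
          wordsPoly K ∈ limitSubmodule E := fun K hK => ih _ hK K rfl
      have h1 : splitPoly x W * wordsPoly L ∈ limitSubmodule E := by
        rw [splitPoly, splitSum_mul]
        refine splitSum_mem _ _ _ _ fun a b hab => ?_
        have := ih' (a :: b :: L) (by simp [totalLength]; omega)
        rwa [wordsPoly_cons, wordsPoly_cons, ← mul_assoc] at this
      have h2 : formalLoopDeriv x W (wordsPoly L) ∈ limitSubmodule E := by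
        simpa [wordsPoly] using wordsPoly_mul_formalLoopDeriv_mem _ ih' x W [] L
          (by simp [totalLength])
      rw [mem_limitSubmodule] at h1 h2 ⊢
      have h3 : Tendsto (fun N : ℕ => (N : ℂ)⁻¹ ^ 2) atTop (𝓝 0) := by
        simpa using (tendsto_inv_atTop_nhds_zero_nat (𝕜 := ℂ)).pow 2
      have h4 := h1.add (h3.mul h2)
      rw [zero_mul, add_zero, map_mul, limitEval_splitPoly, ← map_mul, ← wordsPoly_cons] at h4
      refine h4.congr fun N => ?_
      rw [wordsPoly_cons, map_mul (traceEval N), map_mul (traceEval N),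
        (hE N).loop_equation_traceEval, loopDeriv_traceEval]

/-- Linearity extends the case of monomials; the list `L` accumulates variables so that the
induction on `Q` closes under products. -/
theorem tendsto_traceEval (hE : ∀ N, IsGinibreFunctional (E N)) (Q : TracePoly) :
    Tendsto (fun N => E N (traceEval N Q)) atTop (𝓝 (limitEval Q)) := by
  have h : ∀ L, wordsPoly L * Q ∈ limitSubmodule E := by
    induction Q using MvPolynomial.induction_on with
    | C a =>
      intro L
      rw [mul_comm, ← smul_eq_C_mul]
      exact Submodule.smul_mem _ _ (wordsPoly_mem hE L)
    | add p q hp hq => exact fun L => by rw [mul_add]; exact Submodule.add_mem _ (hp L) (hq L)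
    | mul_X p V hp =>
      intro L
      have := hp (V :: L)
      rwa [wordsPoly_cons, mul_comm (X V), mul_assoc, mul_comm (X V)] at this
  simpa [wordsPoly, mem_limitSubmodule] using h []

end Limit

/-! ### Mixed moments of unnormalized linear statistics -/

section MixedMoments

open MvPolynomial

variable {E : ∀ N, EntryPoly N →ₗ[ℂ] ℂ}

/-- The formal linear statistic `∑ c_k tr(W_k)`. -/
noncomputable def wordSum {κ : Type*} (K : Finset κ) (c : κ → ℂ) (W : κ → StarWord) : TracePoly :=
  ∑ k ∈ K, C (c k) * X (W k)

theorem formalLoopDeriv_wordSum_eq_zero {κ : Type*} {K : Finset κ} (c : κ → ℂ) {W : κ → StarWord}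
    {x : ℕ × Bool} (V : StarWord) (h : ∀ k ∈ K, adjointLetter x ∉ W k) :
    formalLoopDeriv x V (wordSum K c W) = 0 := by
  rw [wordSum, map_sum]
  refine Finset.sum_eq_zero fun k hk => ?_
  rw [← smul_eq_C_mul, Derivation.map_smul, formalLoopDeriv, mkDerivation_X, splitSum_eq_zero (h k hk),
    smul_zero]

theorem splitPoly_eq_zero {x : ℕ × Bool} {W : StarWord} (h : adjointLetter x ∉ W) :
    splitPoly x W = 0 := splitSum_eq_zero h _

/-- The reduction of a mixed moment of unnormalized linear statistics by the loop equation. -/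
theorem IsGinibreFunctional.mixed_moment {N : ℕ} {E : EntryPoly N →ₗ[ℂ] ℂ}
    (hE : IsGinibreFunctional E) {x : ℕ × Bool} {W : StarWord} (hW : adjointLetter x ∉ W)
    {ξ η : TracePoly} (hξ : formalLoopDeriv x W ξ = 0) (hN : N ≠ 0) (a b : ℕ) (Q : TracePoly) :
    E (C (N : ℂ) * traceEval N (X (x :: W)) *
        ((C (N : ℂ) * traceEval N ξ) ^ a * (C (N : ℂ) * traceEval N η) ^ b * traceEval N Q))
      = (N : ℂ)⁻¹ * E ((C (N : ℂ) * traceEval N ξ) ^ a * (C (N : ℂ) * traceEval N η) ^ b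
          * traceEval N (formalLoopDeriv x W Q))
        + b * E ((C (N : ℂ) * traceEval N ξ) ^ a * (C (N : ℂ) * traceEval N η) ^ (b - 1)
          * traceEval N (formalLoopDeriv x W η * Q)) := by
  have hN' : (N : ℂ) ≠ 0 := by exact_mod_cast hN
  have hC : ∀ (c : ℂ) (Q : EntryPoly N), E (C c * Q) = c * E Q := fun c Q => by
    rw [← smul_eq_C_mul, map_smul, smul_eq_mul]
  rw [mul_assoc (C (N : ℂ)), hC, hE.loop_equation_traceEval, splitPoly_eq_zero hW, map_zero,
    zero_mul, map_zero, zero_add]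
  -- Differentiating a factor `N · η` brings out an extra `N`. Against the prefactor `N · N⁻²`, the
  -- term from `η` has order one and the term from `Q` has order `N⁻¹`.
  have hD : loopDeriv N x W
        ((C (N : ℂ) * traceEval N ξ) ^ a * (C (N : ℂ) * traceEval N η) ^ b * traceEval N Q)
      = (C (N : ℂ) * traceEval N ξ) ^ a * (C (N : ℂ) * traceEval N η) ^ b
          * traceEval N (formalLoopDeriv x W Q)
        + C ((b : ℂ) * N) * ((C (N : ℂ) * traceEval N ξ) ^ a
          * (C (N : ℂ) * traceEval N η) ^ (b - 1) * traceEval N (formalLoopDeriv x W η * Q)) := by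
    simp only [Derivation.leibniz, Derivation.leibniz_pow, loopDeriv_traceEval, hξ, map_zero,
      smul_eq_mul, Derivation.map_natCast, nsmul_eq_mul, map_mul, map_natCast]
    ring
  rw [hD, map_add, hC]
  field_simp

/-- Removing one factor of the first statistic reproduces the recursion of the Gaussian moments. The
auxiliary `Q` absorbs the derivatives created on the way; by asymptotic factorization they enter
only through `limitEval`. -/
theorem tendsto_mixed_moment {κ : Type*} {K : Finset κ} {c d : κ → ℂ} {x y : κ → ℕ × Bool}
    {W V : κ → StarWord} (hE : ∀ N, IsGinibreFunctional (E N))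
    (hx : ∀ k ∈ K, ∀ l ∈ K, adjointLetter (x k) ∉ x l :: W l)
    (hy : ∀ k ∈ K, ∀ l ∈ K, adjointLetter (y k) ∉ y l :: V l) {s : ℝ≥0}
    (hs : ∑ k ∈ K, c k * limitEval (formalLoopDeriv (x k) (W k)
      (wordSum K d fun k => y k :: V k)) = (s : ℂ)) (a b : ℕ) (Q : TracePoly) :
    Tendsto (fun N : ℕ => E N ((C (N : ℂ) * traceEval N (wordSum K c fun k => x k :: W k)) ^ a
      * (C (N : ℂ) * traceEval N (wordSum K d fun k => y k :: V k)) ^ b * traceEval N Q))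
      atTop (𝓝 (gaussianMoment s a b * limitEval Q)) := by
  have hC : ∀ (N : ℕ) (c : ℂ) (Q : EntryPoly N), E N (C c * Q) = c * E N Q := fun N c Q => by
    rw [← smul_eq_C_mul, map_smul, smul_eq_mul]
  have hinv : Tendsto (fun N : ℕ => (N : ℂ)⁻¹) atTop (𝓝 0) :=
    tendsto_inv_atTop_nhds_zero_nat (𝕜 := ℂ)
  have hsum : ∀ (N : ℕ) (e : κ → ℂ) (U : κ → StarWord) (R : EntryPoly N),
      E N (C (N : ℂ) * traceEval N (wordSum K e U) * R)
        = ∑ k ∈ K, e k * E N (C (N : ℂ) * traceEval N (X (U k)) * R) := fun N e U R => by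
    rw [wordSum, map_sum, Finset.mul_sum, Finset.sum_mul, map_sum]
    refine Finset.sum_congr rfl fun k _ => ?_
    have h : traceEval N (C (e k)) = C (e k) := (traceEval N).commutes (e k)
    rw [← hC, map_mul (traceEval N), h]
    congr 1
    ring
  induction a generalizing b Q with
  | zero =>
    induction b generalizing Q with
    | zero => simpa [gaussianMoment_eq] using tendsto_traceEval hE Q
    | succ b ih =>
      have h : Tendsto (fun N : ℕ => ∑ k ∈ K, d k * ((N : ℂ)⁻¹ * E N
          ((C (N : ℂ) * traceEval N (wordSum K c fun k => x k :: W k)) ^ 0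
            * (C (N : ℂ) * traceEval N (wordSum K d fun k => y k :: V k)) ^ b
            * traceEval N (formalLoopDeriv (y k) (V k) Q)))) atTop (𝓝 0) := by
        have := tendsto_finsetSum K fun k _ =>
          ((hinv.mul (ih (formalLoopDeriv (y k) (V k) Q))).const_mul (d k))
        simpa using this
      rw [gaussianMoment_succ_right]
      simp only [Nat.cast_zero, zero_mul, mul_zero]
      refine h.congr' ?_
      filter_upwards [eventually_ne_atTop 0] with N hN
      simp only [pow_zero, one_mul]
      rw [pow_succ', mul_assoc, hsum]
      refine Finset.sum_congr rfl fun k hk => ?_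
      -- With no factor of the first kind left, the conjugate statistic plays the role of `ξ` and
      -- nothing remains to pair with, so only the `N⁻¹` term survives.
      have := (hE N).mixed_moment (x := y k) (W := V k)
        (ξ := wordSum K d fun k => y k :: V k) (η := 0)
        (fun h => hy k hk k hk (List.mem_cons_of_mem _ h))
        (formalLoopDeriv_wordSum_eq_zero _ _ fun l hl => hy k hk l hl) hN b 0 Q
      simp only [pow_zero, mul_one, Nat.cast_zero, zero_mul, add_zero] at this
      rw [this]
  | succ a ih =>
    have h : Tendsto (fun N : ℕ => ∑ k ∈ K, c k * ((N : ℂ)⁻¹ * E N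
          ((C (N : ℂ) * traceEval N (wordSum K c fun k => x k :: W k)) ^ a
            * (C (N : ℂ) * traceEval N (wordSum K d fun k => y k :: V k)) ^ b
            * traceEval N (formalLoopDeriv (x k) (W k) Q))
        + b * E N ((C (N : ℂ) * traceEval N (wordSum K c fun k => x k :: W k)) ^ a
            * (C (N : ℂ) * traceEval N (wordSum K d fun k => y k :: V k)) ^ (b - 1)
            * traceEval N (formalLoopDeriv (x k) (W k) (wordSum K d fun k => y k :: V k) * Q))))
        atTop (𝓝 (∑ k ∈ K, c k * (0 + b * (gaussianMoment s a (b - 1)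
          * (limitEval (formalLoopDeriv (x k) (W k) (wordSum K d fun k => y k :: V k))
            * limitEval Q))))) := by
      refine tendsto_finsetSum K fun k _ => Tendsto.const_mul _ (Tendsto.add ?_ ?_)
      · simpa using hinv.mul (ih b (formalLoopDeriv (x k) (W k) Q))
      · rw [← map_mul]
        exact (ih (b - 1) _).const_mul _
    have hlim : ∑ k ∈ K, c k * (0 + b * (gaussianMoment s a (b - 1)
          * (limitEval (formalLoopDeriv (x k) (W k) (wordSum K d fun k => y k :: V k))
            * limitEval Q))) = gaussianMoment s (a + 1) b * limitEval Q := by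
      rw [gaussianMoment_succ_left, ← hs, Finset.sum_mul, Finset.sum_mul]
      exact Finset.sum_congr rfl fun k _ => by ring
    rw [hlim] at h
    refine h.congr' ?_
    filter_upwards [eventually_ne_atTop 0] with N hN
    rw [pow_succ', mul_assoc, mul_assoc, hsum]
    refine Finset.sum_congr rfl fun k hk => ?_
    rw [← mul_assoc (_ ^ a), (hE N).mixed_moment
      (fun h => hx k hk k hk (List.mem_cons_of_mem _ h))
      (formalLoopDeriv_wordSum_eq_zero _ _ fun l hl => hx k hk l hl) hN]

end MixedMoments

/-! ### Limiting covariance of `*`-free words as a count of rotations -/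

section FreeWords

/-- The word `G_{l_1} ⋯ G_{l_m}`. -/
def posWord (l : List ℕ) : StarWord := l.map fun r => (r, false)

/-- The adjoint `G_{l_m}^* ⋯ G_{l_1}^*` of `posWord l`. -/
def negWord (l : List ℕ) : StarWord := (l.map fun r => (r, true)).reverse

theorem posWord_cons (r : ℕ) (l : List ℕ) : posWord (r :: l) = (r, false) :: posWord l := rfl

theorem negWord_cons (r : ℕ) (l : List ℕ) : negWord (r :: l) = negWord l ++ [(r, true)] := by
  simp [negWord]

theorem negWord_append (k l : List ℕ) : negWord (k ++ l) = negWord l ++ negWord k := by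
  simp [negWord]

theorem snd_of_mem_posWord {l : List ℕ} {x : ℕ × Bool} (h : x ∈ posWord l) : x.2 = false := by
  obtain ⟨r, -, rfl⟩ := List.mem_map.1 h
  rfl

theorem snd_of_mem_negWord {l : List ℕ} {x : ℕ × Bool} (h : x ∈ negWord l) : x.2 = true := by
  obtain ⟨r, -, rfl⟩ := List.mem_map.1 (List.mem_reverse.1 h)
  rfl

theorem adjointLetter_notMem {e : Bool} {x : ℕ × Bool} {W : StarWord} (hx : x.2 = e)
    (hW : ∀ y ∈ W, y.2 = e) : adjointLetter x ∉ W := fun h => by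
  have := hW _ h
  simp [adjointLetter, hx] at this

theorem limitTrace_eq_zero {W : StarWord} (e : Bool) (hne : W ≠ []) (hW : ∀ x ∈ W, x.2 = e) :
    limitTrace W = 0 := by
  cases W with
  | nil => exact absurd rfl hne
  | cons x W =>
    rw [limitTrace_cons, splitSum_eq_zero]
    exact adjointLetter_notMem (hW x (by simp)) fun y hy => hW y (List.mem_cons_of_mem _ hy)

theorem limitTrace_posWord_append_negWord (u v : List ℕ) :
    limitTrace (posWord u ++ negWord v) = if u = v then 1 else 0 := by
  induction u generalizing v with
  | nil =>
    cases v with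
    | nil => simp [posWord, negWord, limitTrace_nil]
    | cons r v =>
      rw [limitTrace_eq_zero true]
      · simp
      · simp [posWord, negWord]
      · intro x hx
        exact snd_of_mem_negWord (by simpa [posWord] using hx)
  | cons r u ih =>
    rw [posWord_cons, List.cons_append, limitTrace_cons, splitSum_append, splitSum_eq_zero, zero_add]
    · cases v with
      | nil => simp [negWord]
      | cons r' v =>
        rw [negWord_cons, splitSum_append, splitSum_cons]
        -- Pairing the first letter with anything but the last leaves a nonempty block of adjoints
        -- alone, which has limiting trace zero. Only the fully nested pairing contributes.
        have h0 : splitSum (adjointLetter (r, false)) (negWord v) (fun a b =>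
            limitTrace (posWord u ++ a) * limitTrace (b ++ [(r', true)])) = 0 := by
          refine Finset.sum_eq_zero fun q _ => ?_
          split_ifs
          · beta_reduce
            rw [limitTrace_eq_zero (W := _ ++ [(r', true)]) true (by simp), mul_zero]
            intro x hx
            rcases List.mem_append.1 hx with hx | hx
            · exact snd_of_mem_negWord (List.mem_of_mem_drop hx)
            · simp at hx; simp [hx]
          · rfl
        rw [h0]
        simp only [splitSum_nil, add_zero, zero_add, List.append_nil, limitTrace_nil, mul_one, ih,
          adjointLetter, Bool.not_false, Prod.mk.injEq, and_true, List.cons.injEq]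
        by_cases h1 : r' = r
        · simp [h1]
        · simp [h1, Ne.symm h1]
    · exact adjointLetter_notMem rfl fun y hy => snd_of_mem_posWord hy

theorem splitSum_negWord {M : Type*} [AddCommMonoid M] (r : ℕ) (v : List ℕ)
    (f : StarWord → StarWord → M) :
    splitSum (r, true) (negWord v) f = ∑ q ∈ Finset.range v.length,
      if v[q]? = some r then f (negWord (v.drop (q + 1))) (negWord (v.take q)) else 0 := by
  induction v generalizing f with
  | nil => simp [negWord]
  | cons r' v ih =>
    rw [negWord_cons, splitSum_append, ih, splitSum_cons, List.length_cons, Finset.sum_range_succ']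
    simp [negWord]

/-- Opening the adjoint of `v` at position `q` leaves the adjoint of `v` rotated by `q` with its
first letter removed. Its trace against `u` survives exactly when the rotation is `r :: u`. -/
theorem limitEval_formalLoopDeriv_negWord (r : ℕ) (u v : List ℕ) :
    limitEval (formalLoopDeriv (r, false) (posWord u) (MvPolynomial.X (negWord v)))
      = ((Finset.range v.length).filter fun q => v.rotate q = r :: u).card := by
  rw [formalLoopDeriv, MvPolynomial.mkDerivation_X, map_splitSum]
  simp only [limitEval_X]
  rw [show adjointLetter (r, false) = (r, true) from rfl, splitSum_negWord, Finset.card_filter,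
    Nat.cast_sum]
  refine Finset.sum_congr rfl fun q hq => ?_
  have hq' := Finset.mem_range.1 hq
  rw [List.append_assoc, ← negWord_append, limitTrace_posWord_append_negWord,
    List.rotate_eq_drop_append_take hq'.le, List.drop_eq_getElem_cons hq',
    List.getElem?_eq_getElem hq', List.cons_append]
  simp only [Option.some.injEq, List.cons.injEq]
  by_cases h : v[q] = r
  · simp [h, eq_comm]
  · simp [h]

end FreeWords

/-! ### Gaussian moments for combinations of powers of one word -/

section Powers

open FreeMonoid in
theorem tendsto_mixed_moment_powers {E : ∀ N, EntryPoly N →ₗ[ℂ] ℂ}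
    (hE : ∀ N, IsGinibreFunctional (E N)) {w : FreeMonoid ℕ} (hw : w ≠ 1) (d : ℕ) (c : ℕ → ℂ)
    {s : ℝ≥0} (hs : (s : ℝ) = ∑ k ∈ Finset.range d, ‖c k‖ ^ 2 * ((k + 1) * coperiod w)) (a b : ℕ) :
    Tendsto (fun N : ℕ => E N
      ((MvPolynomial.C (N : ℂ) * traceEval N (wordSum (Finset.range d) c
          fun k => posWord (toList (w ^ (k + 1))))) ^ a
        * (MvPolynomial.C (N : ℂ) * traceEval N (wordSum (Finset.range d) (fun k => conj (c k))
          fun k => negWord (toList (w ^ (k + 1))))) ^ b))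
      atTop (𝓝 (gaussianMoment s a b)) := by
  have hne : ∀ k, toList (w ^ (k + 1)) ≠ [] := fun k h => by
    have h1 := congrArg List.length h
    have h2 : 0 < (toList w).length := List.length_pos_iff.2 (toList_ne_nil hw)
    rw [length_toList_pow] at h1
    exact absurd h1 (Nat.mul_pos k.succ_pos h2).ne'
  choose r u hru using fun k => List.exists_cons_of_ne_nil (hne k)
  choose y V hyV using fun k => List.exists_cons_of_ne_nil
    (show negWord (toList (w ^ (k + 1))) ≠ [] by simpa [negWord] using hne k)
  have hpos : (fun k => posWord (toList (w ^ (k + 1)))) = fun k => (r k, false) :: posWord (u k) := by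
    ext1 k; rw [hru, posWord_cons]
  have hneg : (fun k => negWord (toList (w ^ (k + 1)))) = fun k => y k :: V k := funext hyV
  have hy : ∀ k, ∀ x ∈ y k :: V k, x.2 = true := fun k x hx => by
    rw [← hyV] at hx
    exact snd_of_mem_negWord hx
  have hx : ∀ k, ∀ x ∈ (r k, false) :: posWord (u k), x.2 = false := fun k x hx => by
    rw [← posWord_cons] at hx
    exact snd_of_mem_posWord hx
  -- Distinct powers are asymptotically uncorrelated, so only the diagonal terms survive.
  have hvar : ∑ k ∈ Finset.range d, c k * limitEval (formalLoopDeriv (r k, false) (posWord (u k))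
      (wordSum (Finset.range d) (fun k => conj (c k)) fun k => y k :: V k)) = (s : ℂ) := by
    rw [← hneg]
    have h1 : (s : ℂ) = ((s : ℝ) : ℂ) := rfl
    rw [h1, hs, Complex.ofReal_sum]
    refine Finset.sum_congr rfl fun k hk => ?_
    have h2 : ∀ l, limitEval (formalLoopDeriv (r k, false) (posWord (u k))
        (MvPolynomial.X (negWord (toList (w ^ (l + 1))))))
          = if l = k then (((l + 1) * coperiod w : ℕ) : ℂ) else 0 := fun l => by
      rw [limitEval_formalLoopDeriv_negWord, ← hru, length_toList_pow,
        card_rotate_pow_eq hw _ k.succ_ne_zero]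
      by_cases h : l = k <;> simp [h]
    have h3 : limitEval (formalLoopDeriv (r k, false) (posWord (u k))
        (wordSum (Finset.range d) (fun k => conj (c k)) fun k => negWord (toList (w ^ (k + 1)))))
          = conj (c k) * (((k + 1) * coperiod w : ℕ) : ℂ) := by
      simp only [wordSum, map_sum, ← MvPolynomial.smul_eq_C_mul, Derivation.map_smul, map_smul, h2]
      simp [Finset.mem_range.1 hk]
    rw [h3, ← mul_assoc, Complex.mul_conj, Complex.normSq_eq_norm_sq]
    push_cast
    ring
  have h := tendsto_mixed_moment hE
    (fun k _ l _ => adjointLetter_notMem (x := (r k, false)) rfl (hx l))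
    (fun k _ l _ => adjointLetter_notMem (hy k _ (by simp)) (hy l)) hvar a b 1
  rw [hpos, hneg]
  simpa using h

end Powers

/-! ### Taylor remainder of the exponential on the imaginary axis -/

section ExpBound

/-- The derivative of each remainder is `c` times the previous one, so the bound integrates up from
`|exp| = 1`. -/
theorem norm_exp_sub_sum_le_of_nonneg {c : ℂ} (hc : ‖c‖ = 1) (hre : c.re = 0) (n : ℕ) {y : ℝ}
    (hy : 0 ≤ y) :
    ‖Complex.exp (y * c) - ∑ k ∈ Finset.range n, (y * c) ^ k / (k.factorial : ℂ)‖
      ≤ y ^ n / n.factorial := by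
  induction n generalizing y with
  | zero => simp [Complex.norm_exp, hre]
  | succ n ih =>
    have hd : ∀ x : ℝ, HasDerivAt (fun x : ℝ => Complex.exp (x * c)
        - ∑ k ∈ Finset.range (n + 1), (x * c) ^ k / (k.factorial : ℂ))
        (c * (Complex.exp (x * c) - ∑ k ∈ Finset.range n, (x * c) ^ k / (k.factorial : ℂ))) x := by
      intro x
      have h0 : HasDerivAt (fun x : ℝ => (x : ℂ) * c) c x := by
        simpa using (Complex.ofRealCLM.hasDerivAt (x := x)).mul_const c
      have h1 : HasDerivAt (fun x : ℝ => ∑ k ∈ Finset.range (n + 1),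
          ((x : ℂ) * c) ^ k / (k.factorial : ℂ))
          (c * ∑ k ∈ Finset.range n, (x * c) ^ k / (k.factorial : ℂ)) x := by
        refine (HasDerivAt.fun_sum (u := Finset.range (n + 1)) fun k _ =>
          (h0.pow k).div_const (k.factorial : ℂ)).congr_deriv ?_
        rw [Finset.sum_range_succ', Finset.mul_sum]
        simp only [Nat.cast_zero, zero_mul, zero_div, add_zero]
        refine Finset.sum_congr rfl fun k _ => ?_
        rw [Nat.factorial_succ]
        have h2 : ((k : ℂ) + 1) ≠ 0 := Nat.cast_add_one_ne_zero k
        have h3 : (k.factorial : ℂ) ≠ 0 := by exact_mod_cast k.factorial_ne_zero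
        push_cast
        field_simp
      exact (h0.cexp.sub h1).congr_deriv (by ring)
    have hB : ∀ x : ℝ, HasDerivAt (fun x : ℝ => x ^ (n + 1) / ((n + 1).factorial : ℝ))
        (x ^ n / n.factorial) x := by
      intro x
      refine ((hasDerivAt_pow (n + 1) x).div_const _).congr_deriv ?_
      rw [Nat.factorial_succ]
      have h3 : (n.factorial : ℝ) ≠ 0 := by exact_mod_cast n.factorial_ne_zero
      push_cast
      field_simp
    refine image_norm_le_of_norm_deriv_right_le_deriv_boundary (a := 0) (b := y)
      (fun x _ => (hd x).continuousAt.continuousWithinAt)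
      (fun x _ => (hd x).hasDerivWithinAt) ?_ hB ?_ ⟨hy, le_rfl⟩
    · simp [Finset.sum_range_succ']
    · intro x hx
      rw [norm_mul, hc, one_mul]
      exact ih hx.1

theorem norm_exp_mul_I_sub_sum_le (n : ℕ) (y : ℝ) :
    ‖Complex.exp (y * Complex.I)
        - ∑ k ∈ Finset.range n, (y * Complex.I) ^ k / (k.factorial : ℂ)‖
      ≤ |y| ^ n / n.factorial := by
  rcases le_total 0 y with hy | hy
  · rw [abs_of_nonneg hy]
    exact norm_exp_sub_sum_le_of_nonneg (by simp) (by simp) n hy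
  · rw [abs_of_nonpos hy]
    have := norm_exp_sub_sum_le_of_nonneg (c := -Complex.I) (by simp) (by simp) n
      (neg_nonneg.2 hy)
    simpa using this

end ExpBound

/-! ### The method of moments through characteristic functions -/

section MomentMethod

open scoped RealInnerProductSpace

/-- The moments of a linear marginal of a measure on `ℂ`. -/
noncomputable def linearMoment (ν : Measure ℂ) (t : ℂ) (k : ℕ) : ℂ :=
  ∫ z, ((⟪z, t⟫ : ℝ) : ℂ) ^ k ∂ν

theorem ofReal_inner_eq (z t : ℂ) :
    ((⟪z, t⟫ : ℝ) : ℂ) = (z * conj t + conj z * t) / 2 := by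
  rw [Complex.inner, Complex.re_eq_add_conj]
  simp
  ring

variable {ν : Measure ℂ} [IsProbabilityMeasure ν]

theorem hasAllMoments_inner (hν : HasAllMoments (fun z : ℂ => z) ν) (t : ℂ) :
    HasAllMoments (fun z : ℂ => ((⟪z, t⟫ : ℝ) : ℂ)) ν := by
  have := ((hν.mul (hasAllMoments_const (conj t))).add (hν.star.mul (hasAllMoments_const t))).mul
    (hasAllMoments_const (2⁻¹ : ℂ))
  simpa only [ofReal_inner_eq, div_eq_mul_inv] using this

theorem linearMoment_eq_sum (hν : HasAllMoments (fun z : ℂ => z) ν) (t : ℂ) (k : ℕ) :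
    linearMoment ν t k = ∑ j ∈ Finset.range (k + 1),
      (2⁻¹ ^ k * conj t ^ j * t ^ (k - j) * (k.choose j : ℂ))
        * ∫ z, z ^ j * conj z ^ (k - j) ∂ν := by
  simp only [← integral_const_mul]
  rw [← integral_finsetSum]
  · unfold linearMoment
    congr 1
    ext z
    rw [ofReal_inner_eq, div_eq_inv_mul, mul_pow, add_pow, Finset.mul_sum]
    exact Finset.sum_congr rfl fun j _ => by ring
  · exact fun j _ => ((hν.pow j).mul (hν.star.pow (k - j))).integrable.const_mul _

/-- The even order `2 * m` makes the absolute moment in the Taylor remainder an ordinary moment,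
whose convergence is available. -/
theorem norm_charFun_sub_sum_le (hν : HasAllMoments (fun z : ℂ => z) ν) (t : ℂ) (m : ℕ) :
    ‖charFun ν t - ∑ k ∈ Finset.range (2 * m),
        (Complex.I ^ k / (k.factorial : ℂ)) * linearMoment ν t k‖
      ≤ ‖linearMoment ν t (2 * m)‖ / (2 * m).factorial := by
  have hI := hasAllMoments_inner hν t
  have h1 : ∀ k, Integrable (fun z : ℂ => ((⟪z, t⟫ : ℝ) * Complex.I) ^ k / (k.factorial : ℂ)) ν :=
    fun k => by
      simp only [mul_pow]
      exact ((hI.pow k).integrable.mul_const _).div_const _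
  have h2 : Integrable (fun z : ℂ => Complex.exp ((⟪z, t⟫ : ℝ) * Complex.I)) ν := by
    refine (integrable_const (1 : ℝ)).mono (by fun_prop) (ae_of_all _ fun z => ?_)
    rw [Complex.norm_exp_ofReal_mul_I, norm_one]
  have h3 : Integrable (fun z : ℂ => (⟪z, t⟫ : ℝ) ^ (2 * m)) ν := by
    have := (hI.pow (2 * m)).integrable.re
    refine this.congr (ae_of_all _ fun z => ?_)
    simp only [← Complex.ofReal_pow]
    exact Complex.ofReal_re _
  have h4 : charFun ν t - ∑ k ∈ Finset.range (2 * m),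
        (Complex.I ^ k / (k.factorial : ℂ)) * linearMoment ν t k
      = ∫ z, (Complex.exp ((⟪z, t⟫ : ℝ) * Complex.I) - ∑ k ∈ Finset.range (2 * m),
        ((⟪z, t⟫ : ℝ) * Complex.I) ^ k / (k.factorial : ℂ)) ∂ν := by
    rw [integral_sub h2 (integrable_finsetSum _ fun k _ => h1 k), integral_finsetSum _ fun k _ => h1 k,
      charFun_apply]
    congr 1
    refine Finset.sum_congr rfl fun k _ => ?_
    rw [linearMoment, ← integral_const_mul]
    congr 1
    ext z
    ring
  have h5 : linearMoment ν t (2 * m) = ((∫ z, (⟪z, t⟫ : ℝ) ^ (2 * m) ∂ν : ℝ) : ℂ) := by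
    rw [linearMoment, ← integral_complex_ofReal]
    simp
  have h6 : 0 ≤ ∫ z, (⟪z, t⟫ : ℝ) ^ (2 * m) ∂ν :=
    integral_nonneg fun z => (even_two_mul m).pow_nonneg _
  rw [h4, h5, Complex.norm_real, Real.norm_of_nonneg h6, ← integral_div]
  refine norm_integral_le_of_norm_le (h3.div_const _) (ae_of_all _ fun z => ?_)
  have := norm_exp_mul_I_sub_sum_le (2 * m) ⟪z, t⟫
  rwa [(even_two_mul m).pow_abs] at this

/-- Cauchy–Schwarz reduces to `E|z|^(2m) = m! s^m`, and `(m!)² ≤ (2m)!` does the rest. -/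
theorem norm_linearMoment_complexGaussian_le (s : ℝ≥0) (t : ℂ) (m : ℕ) :
    ‖linearMoment (complexGaussian s) t (2 * m)‖ / (2 * m).factorial
      ≤ (‖t‖ ^ 2 * s) ^ m / m.factorial := by
  have h1 : Integrable (fun z : ℂ => ‖z‖ ^ (2 * m)) (complexGaussian s) := by
    have := (((hasAllMoments_complexGaussian s).pow (2 * m)).integrable).norm
    simpa using this
  have h2 : ∫ z : ℂ, ‖z‖ ^ (2 * m) ∂complexGaussian s = m.factorial * (s : ℝ) ^ m := by
    have h := gaussianMoment_eq s m m
    rw [if_pos rfl, gaussianMoment] at h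
    have h3 : ∀ z : ℂ, z ^ m * conj z ^ m = ((‖z‖ ^ (2 * m) : ℝ) : ℂ) := fun z => by
      rw [← mul_pow, Complex.mul_conj, Complex.normSq_eq_norm_sq, pow_mul]
      push_cast; rfl
    simp only [h3, integral_complex_ofReal] at h
    exact_mod_cast h
  have h4 : ‖linearMoment (complexGaussian s) t (2 * m)‖
      ≤ m.factorial * (s : ℝ) ^ m * ‖t‖ ^ (2 * m) := by
    rw [← h2, ← integral_mul_const]
    refine norm_integral_le_of_norm_le (h1.mul_const _) (ae_of_all _ fun z => ?_)
    rw [norm_pow, Complex.norm_real, ← mul_pow]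
    exact pow_le_pow_left₀ (norm_nonneg _) (norm_inner_le_norm z t) _
  have h5 : (m.factorial * m.factorial : ℝ) ≤ (2 * m).factorial := by
    have := Nat.le_of_dvd (Nat.factorial_pos _) (Nat.factorial_mul_factorial_dvd_factorial_add m m)
    rw [← two_mul] at this
    exact_mod_cast this
  have hm : (0 : ℝ) < m.factorial := by exact_mod_cast m.factorial_pos
  rw [div_le_div_iff₀ (by positivity) hm]
  calc _ ≤ m.factorial * (s : ℝ) ^ m * ‖t‖ ^ (2 * m) * m.factorial := by gcongr
    _ = (‖t‖ ^ 2 * s) ^ m * (m.factorial * m.factorial) := by ring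
    _ ≤ _ := by gcongr

/-- The method of moments for a complex Gaussian limit. -/
theorem tendsto_charFun_of_tendsto_moments {ν : ℕ → Measure ℂ} [∀ N, IsProbabilityMeasure (ν N)]
    (hν : ∀ N, HasAllMoments (fun z : ℂ => z) (ν N)) {s : ℝ≥0}
    (h : ∀ a b, Tendsto (fun N => ∫ z, z ^ a * conj z ^ b ∂ν N) atTop (𝓝 (gaussianMoment s a b)))
    (t : ℂ) :
    Tendsto (fun N => charFun (ν N) t) atTop (𝓝 (charFun (complexGaussian s) t)) := by
  have hlin : ∀ k, Tendsto (fun N => linearMoment (ν N) t k) atTop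
      (𝓝 (linearMoment (complexGaussian s) t k)) := fun k => by
    simp only [fun N => linearMoment_eq_sum (hν N) t k,
      linearMoment_eq_sum (hasAllMoments_complexGaussian s) t k]
    exact tendsto_finsetSum _ fun j _ => (h j (k - j)).const_mul _
  rw [Metric.tendsto_atTop']
  intro ε hε
  -- Fix `m` from the Gaussian tail first; convergence of the `2m`-th moment then gives the same
  -- remainder bound for all large `N`.
  have hsmall : ∀ᶠ m : ℕ in atTop, (‖t‖ ^ 2 * s) ^ m / (m.factorial : ℝ) < ε / 4 :=
    (FloorSemiring.tendsto_pow_div_factorial_atTop (‖t‖ ^ 2 * (s : ℝ))).eventually_lt_const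
      (by positivity)
  obtain ⟨m, hm⟩ := hsmall.exists
  have hγ := (norm_linearMoment_complexGaussian_le s t m).trans_lt hm
  have h1 : ∀ᶠ N in atTop, ‖linearMoment (ν N) t (2 * m)‖ / (2 * m).factorial < ε / 4 :=
    ((hlin (2 * m)).norm.div_const _).eventually_lt_const hγ
  have h2 : Tendsto (fun N => ∑ k ∈ Finset.range (2 * m),
        (Complex.I ^ k / (k.factorial : ℂ)) * linearMoment (ν N) t k) atTop
      (𝓝 (∑ k ∈ Finset.range (2 * m),
        (Complex.I ^ k / (k.factorial : ℂ)) * linearMoment (complexGaussian s) t k)) :=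
    tendsto_finsetSum _ fun k _ => (hlin k).const_mul _
  have h3 := (Metric.tendsto_nhds.1 h2) (ε / 4) (by positivity)
  obtain ⟨n, hn⟩ := (h1.and h3).exists_forall_of_atTop
  refine ⟨n, fun N hN => ?_⟩
  obtain ⟨h4, h5⟩ := hn N (le_of_lt hN)
  have h6 := norm_charFun_sub_sum_le (hν N) t m
  have h7 := norm_charFun_sub_sum_le (hasAllMoments_complexGaussian s) t m
  rw [← dist_eq_norm] at h6 h7
  rw [dist_comm] at h7
  calc _ ≤ _ := dist_triangle4 _ _ _ _
    _ < ε / 4 + ε / 4 + ε / 4 := by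
      gcongr
      · exact h6.trans_lt h4
      · exact h7.trans_lt hγ
    _ < ε := by linarith

theorem tendstoInDistribution_of_tendsto_moments {Ω : ℕ → Type*} [∀ N, MeasurableSpace (Ω N)]
    {P : ∀ N, Measure (Ω N)} [∀ N, IsProbabilityMeasure (P N)] {X : ∀ N, Ω N → ℂ}
    (hX : ∀ N, HasAllMoments (X N) (P N)) {s : ℝ≥0}
    (h : ∀ a b, Tendsto (fun N => ∫ ω, X N ω ^ a * conj (X N ω) ^ b ∂P N) atTop
      (𝓝 (gaussianMoment s a b))) :
    TendstoInDistribution X atTop (id : ℂ → ℂ) P (complexGaussian s) := by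
  have hm : ∀ N, AEMeasurable (X N) (P N) := fun N => (hX N 1).aestronglyMeasurable.aemeasurable
  refine ⟨hm, aemeasurable_id, ?_⟩
  refine ProbabilityMeasure.tendsto_of_tendsto_charFun fun t => ?_
  have : ∀ N, IsProbabilityMeasure ((P N).map (X N)) := fun N =>
    Measure.isProbabilityMeasure_map (hm N)
  simp only [ProbabilityMeasure.coe_mk, Measure.map_id]
  refine tendsto_charFun_of_tendsto_moments (fun N p => ?_) (fun a b => ?_) t
  · rw [memLp_map_measure_iff (by fun_prop) (hm N)]
    exact hX N p
  · refine (h a b).congr fun N => ?_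
    rw [integral_map (hm N) (by fun_prop)]

end MomentMethod

/-! ### Orthogonality of monomials on the disk and the Dirichlet energy -/

section DiskMoments

theorem integral_exp_int_mul_I (n : ℤ) :
    ∫ θ : ℝ in Set.Ioo (-Real.pi) Real.pi, Complex.exp (n * θ * Complex.I)
      = if n = 0 then 2 * (Real.pi : ℂ) else 0 := by
  have hpi : -Real.pi ≤ Real.pi := by linarith [Real.pi_pos]
  rw [← integral_Ioc_eq_integral_Ioo, ← intervalIntegral.integral_of_le hpi]
  split_ifs with h
  · simp [h]; ring
  · have hc : (n : ℂ) * Complex.I ≠ 0 := mul_ne_zero (by exact_mod_cast h) Complex.I_ne_zero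
    have h1 : ∀ θ : ℝ, Complex.exp (n * θ * Complex.I) = Complex.exp (n * Complex.I * θ) :=
      fun θ => by congr 1; ring
    simp only [h1]
    rw [integral_exp_mul_complex hc, div_eq_zero_iff]
    left
    rw [sub_eq_zero, Complex.exp_eq_exp_iff_exists_int]
    exact ⟨n, by push_cast; ring⟩

theorem integral_ofReal_pow_Ioo (m : ℕ) :
    ∫ r : ℝ in Set.Ioo (0 : ℝ) 1, (r : ℂ) ^ m = 1 / ((m : ℂ) + 1) := by
  rw [← integral_Ioc_eq_integral_Ioo, ← intervalIntegral.integral_of_le zero_le_one]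
  have := integral_pow (a := (0 : ℝ)) (b := 1) m
  have h2 : ∫ r : ℝ in (0 : ℝ)..1, (r : ℂ) ^ m = ((∫ r : ℝ in (0 : ℝ)..1, r ^ m : ℝ) : ℂ) := by
    rw [← intervalIntegral.integral_ofReal]
    simp
  rw [h2, this]
  simp

theorem integral_ball_pow_mul_conj_pow (j k : ℕ) :
    ∫ z in Metric.ball (0 : ℂ) 1, z ^ j * conj z ^ k
      = if j = k then (Real.pi : ℂ) / (j + 1) else 0 := by
  rw [← integral_indicator Metric.isOpen_ball.measurableSet,
    ← Complex.integral_comp_polarCoord_symm]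
  have h1 : ∀ p : ℝ × ℝ, p.1 • (Metric.ball (0 : ℂ) 1).indicator (fun z => z ^ j * conj z ^ k)
        (Complex.polarCoord.symm p)
      = {p : ℝ × ℝ | |p.1| < 1}.indicator (fun p : ℝ × ℝ => (p.1 : ℂ) ^ (j + k + 1)
          * Complex.exp (((j - k : ℤ) : ℂ) * p.2 * Complex.I)) p := fun p => by
    have h2 : Complex.polarCoord.symm p ∈ Metric.ball (0 : ℂ) 1 ↔ p ∈ {p : ℝ × ℝ | |p.1| < 1} := by
      rw [mem_ball_zero_iff, Complex.norm_polarCoord_symm]; rfl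
    by_cases h : p ∈ {p : ℝ × ℝ | |p.1| < 1}
    · rw [Set.indicator_of_mem h, Set.indicator_of_mem (h2.2 h), Complex.polarCoord_symm_apply,
        Complex.ofReal_cos, Complex.ofReal_sin, ← Complex.exp_mul_I, map_mul, Complex.conj_ofReal,
        ← Complex.exp_conj, map_mul, Complex.conj_ofReal, Complex.conj_I, mul_pow, mul_pow,
        ← Complex.exp_nat_mul, ← Complex.exp_nat_mul, Complex.real_smul]
      have h3 : Complex.exp (((j - k : ℤ) : ℂ) * p.2 * Complex.I)
          = Complex.exp (j * (p.2 * Complex.I)) * Complex.exp (k * (p.2 * -Complex.I)) := by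
        rw [← Complex.exp_add]; congr 1; push_cast; ring
      rw [h3]
      ring
    · rw [Set.indicator_of_notMem h, Set.indicator_of_notMem (fun h' => h (h2.1 h')), smul_zero]
  -- The disk condition reads `|r| < 1`; positivity of `r` on the polar chart makes the domain a
  -- rectangle, where the integral factors.
  have h4 : polarCoord.target ∩ {p : ℝ × ℝ | |p.1| < 1}
      = Set.Ioo (0 : ℝ) 1 ×ˢ Set.Ioo (-Real.pi) Real.pi := by
    ext p
    simp only [polarCoord_target, Set.mem_inter_iff, Set.mem_prod, Set.mem_Ioi, Set.mem_Ioo,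
      Set.mem_ofPred_eq]
    constructor
    · rintro ⟨⟨h0, h1⟩, h2⟩
      exact ⟨⟨h0, by rwa [abs_of_pos h0] at h2⟩, h1⟩
    · rintro ⟨⟨h0, h2⟩, h1⟩
      exact ⟨⟨h0, h1⟩, by rwa [abs_of_pos h0]⟩
  simp only [h1]
  rw [setIntegral_indicator (measurableSet_lt (by fun_prop) (by fun_prop)), h4,
    Measure.volume_eq_prod]
  rw [setIntegral_prod_mul (fun r : ℝ => (r : ℂ) ^ (j + k + 1))
    (fun θ : ℝ => Complex.exp (((j - k : ℤ) : ℂ) * θ * Complex.I)), integral_exp_int_mul_I,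
    integral_ofReal_pow_Ioo]
  by_cases h : j = k
  · subst h
    have h5 : ((j : ℂ) + 1) ≠ 0 := Nat.cast_add_one_ne_zero j
    have h6 : (((j + j + 1 : ℕ) : ℂ) + 1) = 2 * (j + 1) := by push_cast; ring
    rw [h6]
    simp
    field_simp
  · have h7 : (j - k : ℤ) ≠ 0 := by omega
    simp [h, h7]

theorem integral_ball_norm_sq_sum (n : ℕ) (b : ℕ → ℂ) :
    ∫ z in Metric.ball (0 : ℂ) 1, ‖∑ k ∈ Finset.range n, b k * z ^ k‖ ^ 2
      = ∑ k ∈ Finset.range n, ‖b k‖ ^ 2 * (Real.pi / (k + 1)) := by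
  have hint : ∀ j k : ℕ, IntegrableOn (fun z : ℂ => b j * conj (b k) * (z ^ j * conj z ^ k))
      (Metric.ball 0 1) := fun j k => by
    have : ContinuousOn (fun z : ℂ => b j * conj (b k) * (z ^ j * conj z ^ k))
        (Metric.closedBall 0 1) := by fun_prop
    exact (this.integrableOn_compact (isCompact_closedBall 0 1)).mono_set Metric.ball_subset_closedBall
  have h1 : ∀ z : ℂ, ((‖∑ k ∈ Finset.range n, b k * z ^ k‖ ^ 2 : ℝ) : ℂ)
      = ∑ j ∈ Finset.range n, ∑ k ∈ Finset.range n, b j * conj (b k) * (z ^ j * conj z ^ k) :=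
    fun z => by
      rw [← Complex.normSq_eq_norm_sq, ← Complex.mul_conj, map_sum, Finset.sum_mul_sum]
      refine Finset.sum_congr rfl fun j _ => Finset.sum_congr rfl fun k _ => ?_
      simp only [map_mul, map_pow]
      ring
  apply Complex.ofReal_injective
  rw [← integral_complex_ofReal]
  simp only [h1]
  rw [integral_finsetSum _ fun j _ => integrable_finsetSum _ fun k _ => hint j k]
  simp only [integral_finsetSum _ fun k _ => hint _ k, integral_const_mul,
    integral_ball_pow_mul_conj_pow]
  rw [Complex.ofReal_sum]
  refine Finset.sum_congr rfl fun j hj => ?_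
  simp only [mul_ite, mul_zero, Finset.sum_ite_eq, hj, if_true, Complex.mul_conj,
    Complex.normSq_eq_norm_sq]
  push_cast
  ring

theorem dirichletEnergy_eq_sum (f : ℂ[X]) :
    dirichletEnergy f = ∑ k ∈ Finset.range f.natDegree, ‖f.coeff (k + 1)‖ ^ 2 * (k + 1) := by
  have h1 : ∀ z, deriv (fun x => f.eval x) z
      = ∑ k ∈ Finset.range f.natDegree, (f.coeff (k + 1) * (k + 1)) * z ^ k := fun z => by
    rw [Polynomial.deriv]
    by_cases h : f.natDegree = 0
    · simp [Polynomial.derivative_of_natDegree_zero h, h]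
    · rw [Polynomial.eval_eq_sum_range' (Polynomial.natDegree_derivative_lt h)]
      simp [Polynomial.coeff_derivative]
  have hpi := Real.pi_ne_zero
  simp only [dirichletEnergy, h1, integral_ball_norm_sq_sum, Finset.mul_sum]
  refine Finset.sum_congr rfl fun k _ => ?_
  have h2 : ((k : ℝ) + 1) ≠ 0 := Nat.cast_add_one_ne_zero k
  have h3 : ‖(k : ℂ) + 1‖ = k + 1 := by exact_mod_cast Complex.norm_natCast (k + 1)
  rw [norm_mul, h3]
  field_simp

end DiskMoments

/-! ### The Ginibre expectation satisfies integration by parts -/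

section Ginibre

open MvPolynomial

variable {Ω : Type*} [MeasurableSpace Ω] {P : Measure Ω} {N : ℕ}
  {G : ℕ → Ω → Matrix (Fin N) (Fin N) ℂ}

/-- The entries of the matrices as a single family. -/
def entries (G : ℕ → Ω → Matrix (Fin N) (Fin N) ℂ) (p : ℕ × Fin N × Fin N) (ω : Ω) : ℂ :=
  G p.1 ω p.2.1 p.2.2

theorem IsIIDGinibre.hasLaw_entries (hG : IsIIDGinibre P N G) (p : ℕ × Fin N × Fin N) :
    HasLaw (entries G p) (complexGaussian (N : ℝ≥0)⁻¹) P := hG.law p.1 p.2.1 p.2.2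

variable [IsProbabilityMeasure P]

/-- The expectation as a linear functional on entry polynomials. -/
noncomputable def IsIIDGinibre.expectation (hG : IsIIDGinibre P N G) : EntryPoly N →ₗ[ℂ] ℂ where
  toFun := polyExp P (entries G)
  map_add' := polyExp_add hG.hasLaw_entries
  map_smul' c Q := by rw [smul_eq_C_mul, polyExp_C_mul]; rfl

theorem IsIIDGinibre.isGinibreFunctional (hG : IsIIDGinibre P N G) :
    IsGinibreFunctional hG.expectation where
  map_one := polyExp_one
  map_X_mul x i j Q := by
    have h := fun p e => polyExp_X_mul (Z := entries G) hG.indep hG.hasLaw_entries p e Q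
    have hN : (((N : ℝ≥0)⁻¹ : ℝ≥0) : ℂ) = (N : ℂ)⁻¹ := by push_cast; rfl
    rw [← hN]
    rcases x with ⟨r, _ | _⟩
    · exact h (r, i, j) false
    · exact h (r, j, i) true

end Ginibre

/-! ### From formal trace polynomials back to the random matrices, and conclusion -/

section Evaluation

open MvPolynomial

variable {Ω : Type*} {N : ℕ} (G : ℕ → Ω → Matrix (Fin N) (Fin N) ℂ)

theorem trace_map_starWordMatrix (ω : Ω) (W : StarWord) :
    aeval (conjVars (entries G) ω) (starWordMatrix N W).trace
      = ((W.map fun x : ℕ × Bool => if x.2 then (G x.1 ω).conjTranspose else G x.1 ω).prod).trace := by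
  have h1 : ((aeval (conjVars (entries G) ω) : EntryPoly N →ₐ[ℂ] ℂ) : EntryPoly N →+* ℂ).mapMatrix
        (starWordMatrix N W)
      = (W.map fun x : ℕ × Bool => if x.2 then (G x.1 ω).conjTranspose else G x.1 ω).prod := by
    rw [starWordMatrix, map_list_prod, List.map_map]
    congr 2
    ext x i j
    rcases x with ⟨r, _ | _⟩ <;>
      simp [letterMatrix, entryVar, conjVars, entries]
  rw [← h1, Matrix.trace, Matrix.trace, map_sum]
  rfl

theorem prod_map_posWord (A : ℕ → Matrix (Fin N) (Fin N) ℂ) (l : List ℕ) :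
    ((posWord l).map fun x : ℕ × Bool => if x.2 then (A x.1).conjTranspose else A x.1).prod
      = (l.map A).prod := by
  simp [posWord, Function.comp_def]

theorem prod_map_negWord (A : ℕ → Matrix (Fin N) (Fin N) ℂ) (l : List ℕ) :
    ((negWord l).map fun x : ℕ × Bool => if x.2 then (A x.1).conjTranspose else A x.1).prod
      = (l.map A).prod.conjTranspose := by
  simp [negWord, Function.comp_def, Matrix.conjTranspose_list_prod, List.map_reverse]

theorem aeval_wordSum (ω : Ω) {κ : Type*} (K : Finset κ) (c : κ → ℂ) (W : κ → StarWord) :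
    aeval (conjVars (entries G) ω) (C (N : ℂ) * traceEval N (wordSum K c W))
      = ∑ k ∈ K, c k *
        (((W k).map fun x : ℕ × Bool => if x.2 then (G x.1 ω).conjTranspose else G x.1 ω).prod).trace := by
  rw [wordSum, map_sum, Finset.mul_sum, map_sum]
  refine Finset.sum_congr rfl fun k _ => ?_
  have h : traceEval N (C (c k)) = C (c k) := (traceEval N).commutes (c k)
  rw [map_mul (traceEval N), h, traceEval_X, map_mul, map_mul, map_mul, trace_map_starWordMatrix]
  simp only [aeval_C, Algebra.algebraMap_self, RingHom.id_apply]
  -- Cancelling `N * N⁻¹` needs `N ≠ 0`; for empty matrices all traces vanish.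
  rcases Nat.eq_zero_or_pos N with rfl | hN
  · simp [Matrix.trace]
  · have hN' : (N : ℂ) ≠ 0 := by exact_mod_cast hN.ne'
    field_simp

open FreeMonoid in
theorem trace_wordMatrix_pow (A : ℕ → Matrix (Fin N) (Fin N) ℂ) (w : FreeMonoid ℕ) (k : ℕ) :
    ((toList (w ^ k)).map A).prod = wordMatrix w A ^ k := by
  rw [wordMatrix, ← map_pow, FreeMonoid.lift_apply]

open FreeMonoid in
theorem aeval_wordSum_posWord (ω : Ω) (w : FreeMonoid ℕ) (f : ℂ[X]) :
    aeval (conjVars (entries G) ω) (C (N : ℂ) * traceEval N (wordSum (Finset.range f.natDegree)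
        (fun k => f.coeff (k + 1)) fun k => posWord (toList (w ^ (k + 1)))))
      = linearStatistic f (wordMatrix w fun r => G r ω) - (N : ℂ) * f.eval 0 := by
  rw [aeval_wordSum, linearStatistic_sub_eq]
  refine Finset.sum_congr rfl fun k _ => ?_
  rw [prod_map_posWord (fun r => G r ω), trace_wordMatrix_pow]

open FreeMonoid in
theorem aeval_wordSum_negWord (ω : Ω) (w : FreeMonoid ℕ) (f : ℂ[X]) :
    aeval (conjVars (entries G) ω) (C (N : ℂ) * traceEval N (wordSum (Finset.range f.natDegree)
        (fun k => conj (f.coeff (k + 1))) fun k => negWord (toList (w ^ (k + 1)))))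
      = conj (linearStatistic f (wordMatrix w fun r => G r ω) - (N : ℂ) * f.eval 0) := by
  rw [aeval_wordSum, linearStatistic_sub_eq, map_sum]
  refine Finset.sum_congr rfl fun k _ => ?_
  rw [prod_map_negWord (fun r => G r ω), trace_wordMatrix_pow, Matrix.trace_conjTranspose, map_mul]
  rfl

end Evaluation

theorem mainTheorem11 (w : FreeMonoid ℕ) (hw : w ≠ 1) (f : ℂ[X])
    {Ω : ℕ → Type*} [∀ N, MeasurableSpace (Ω N)]
    (P : ∀ N, Measure (Ω N)) [∀ N, IsProbabilityMeasure (P N)]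
    (G : ∀ N, ℕ → Ω N → Matrix (Fin N) (Fin N) ℂ)
    (hG : ∀ N, IsIIDGinibre (P N) N (G N)) :
    TendstoInDistribution
      (fun N ω => linearStatistic f (wordMatrix w (fun r => G N r ω)) - (N : ℂ) * f.eval 0)
      atTop (id : ℂ → ℂ) P (complexGaussian (limitVariance w f)) := by
  refine tendstoInDistribution_of_tendsto_moments (fun N => ?_) fun a b => ?_
  · simp only [← aeval_wordSum_posWord (G N)]
    exact hasAllMoments_aeval (hG N).hasLaw_entries _
  · have hs : ((limitVariance w f : ℝ≥0) : ℝ) = ∑ k ∈ Finset.range f.natDegree,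
        ‖f.coeff (k + 1)‖ ^ 2 * ((k + 1) * coperiod w) := by
      change (coperiod w : ℝ) * dirichletEnergy f = _
      rw [dirichletEnergy_eq_sum, Finset.mul_sum]
      exact Finset.sum_congr rfl fun k _ => by ring
    refine (tendsto_mixed_moment_powers (fun N => (hG N).isGinibreFunctional) hw f.natDegree
      (fun k => f.coeff (k + 1)) hs a b).congr fun N => ?_
    change polyExp _ _ _ = _
    simp only [polyExp, map_mul, map_pow]
    congr 1
    ext ω
    rw [← map_mul, ← map_mul, aeval_wordSum_posWord (G N), aeval_wordSum_negWord (G N)]
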